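/- **Theorem 1.3.** Let $A$ be an artin algebra, i.e. an algebra over a commutative artinian ring $R$ which is finitely generated as an $R$-module, and suppose that $\operatorname{gl.dim} A\le 2$ (every finitely generated right $A$-module has projective dimension at most two). Then: 1. $A$ is right-strongly quasi-hereditary; 2. $A$ is left-strongly quasi-hereditary, i.e. $A^{\mathrm{op}}$ is right-strongly quasi-hereditary; 3. there are idempotents $e_0,\dots,e_n$ of $A$ such that $\operatorname{proj}A=\operatorname{add}e_0A\supset\operatorname{add}e_1A\supset\cdots\supset\operatorname{add}e_nA=0$ is a total right rejective chain of $\operatorname{proj}A$; 4. there are idempotents $\epsilon_0,\dots,\epsilon_m$ of $A$ such that $\operatorname{proj}A=\operatorname{add}\epsilon_0A\supset\operatorname{add}\epsilon_1A\supset\cdots\supset\operatorname{add}\epsilon_mA=0$ is a total left rejective chain of $\operatorname{proj}A$. Here $\operatorname{proj}A$ is the category of finitely generated projective right $A$-modules, $\operatorname{add}M$ is the full subcategory of direct summands of finite direct sums of copies of $M$, and the inclusions in the chains are strict. *Right-strongly quasi-hereditary.* Let $\{S(i)\}_{i\in I}$ be a complete set of representatives of the isomorphism classes of simple right $A$-modules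 and $P(i)$ the projective cover of $S(i)$. For a partial order $\le$ on $I$ let $\Delta(i)$ be the maximal factor module of $P(i)$ all of whose composition factors are of the form $S(j)$ with $j\le i$, and let $K(i)$ be the kernel of $P(i)\to\Delta(i)$. The algebra $A$ is right-strongly quasi-hereditary if for some partial order on $I$ and all $i\in I$: the module $S(i)$ occurs exactly once as a composition factor of $\Delta(i)$; the module $K(i)$ has a finite filtration whose subquotients are isomorphic to modules $\Delta(j)$ with $i<j$; and $K(i)$ is projective. *Total rejective chains.* A full subcategory $\mathcal C'$ of an additive category $\mathcal C$ is right (resp. left) rejective if the inclusion $\mathcal C'\hookrightarrow\mathcal C$ has a right (resp. left) adjoint whose counit (resp. unit) is a monomorphism (resp. an epimorphism) in $\mathcal C$ at every object. For a full subcategory $\mathcal C'$ of a Krull–Schmidt category $\mathcal D$, let $[\mathcal C']$ be the ideal of morphisms that factor through an object of $\mathcal C'$; then $\mathcal C'$ is cosemisimple in $\mathcal D$ if the factor category $\mathcal D/[\mathcal C']$ has zero Jacobson radical. A chain $\mathcal C=\mathcal C_0\supset\mathcal C_1\supset\cdots\supset\mathcal C_n=0$ is a total right (resp. left) rejective chain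 if for $1\le i\le n$ the subcategory $\mathcal C_i$ is right (resp. left) rejective in $\mathcal C$ and cosemisimple in $\mathcal C_{i-1}$. -/

import Mathlib

universe u v w

namespace StronglyQH

open CategoryTheory CategoryTheory.Limits

/-! Right modules over a ring `A` are modules over the opposite ring `Aᵐᵒᵖ`. -/

/-! ### Global dimension -/

/-- The global dimension of `A`: the supremum of the projective dimensions of the finitely
generated right `A`-modules (`⊥` for the zero ring). -/
noncomputable def globalDimension (A : Type u) [Ring A] : WithBot ℕ∞ :=
  ⨆ (M : ModuleCat.{u} Aᵐᵒᵖ) (_ : Module.Finite Aᵐᵒᵖ M), projectiveDimension M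

/-! ### Modules: projective covers, composition factors, filtrations -/

section Modules

variable {B : Type u} [Ring B]

/-- `π : P → M` is a projective cover: `P` is projective and `π` is surjective with superfluous
kernel. -/
structure IsProjectiveCover {P M : Type v} [AddCommGroup P] [Module B P] [AddCommGroup M]
    [Module B M] (π : P →ₗ[B] M) : Prop where
  projective : Module.Projective B P
  surjective : Function.Surjective π
  superfluous : ∀ N : Submodule B P, N ⊔ LinearMap.ker π = ⊤ → N = ⊤

/-- The simple module `S` is a composition factor of `M`, i.e. isomorphic to a subquotient `L/N`
of `M`. -/
def IsCompositionFactor (S : Type v) [AddCommGroup S] [Module B S]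
    (M : Type w) [AddCommGroup M] [Module B M] : Prop :=
  ∃ L N : Submodule B M, N ≤ L ∧ Nonempty ((L ⧸ N.submoduleOf L) ≃ₗ[B] S)

/-- `M` has a finite filtration `M = F 0 ⊇ F 1 ⊇ ⋯ ⊇ F l = 0` each of whose subquotients is
isomorphic to some `X j` with `j ∈ T`. -/
def HasFiltration {J : Type w} (X : J → ModuleCat.{u} B) (T : Set J)
    (M : Type u) [AddCommGroup M] [Module B M] : Prop :=
  ∃ (l : ℕ) (F : Fin (l + 1) → Submodule B M), F 0 = ⊤ ∧ F (Fin.last l) = ⊥ ∧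
    ∀ k : Fin l, F k.succ ≤ F k.castSucc ∧
      ∃ j ∈ T, Nonempty ((F k.castSucc ⧸ (F k.succ).submoduleOf (F k.castSucc)) ≃ₗ[B] X j)

/-- A complete set of representatives `S i`, `i ∈ I`, of the isomorphism classes of simple
`B`-modules, together with a projective cover `π i : P i → S i` of each of them. -/
structure SimplesWithCovers (B : Type u) [Ring B] (I : Type w) where
  S : I → ModuleCat.{u} B
  simple : ∀ i, IsSimpleModule B (S i)
  eq_of_iso : ∀ i j, Nonempty (S i ≃ₗ[B] S j) → i = j
  exists_iso : ∀ T : ModuleCat.{u} B, IsSimpleModule B T → ∃ i, Nonempty (T ≃ₗ[B] S i)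
  P : I → ModuleCat.{u} B
  π : ∀ i, P i →ₗ[B] S i
  isProjectiveCover : ∀ i, IsProjectiveCover (π i)

namespace SimplesWithCovers

variable {I : Type w} [PartialOrder I] (D : SimplesWithCovers B I)

/-- The kernel `K(i)` of `P(i) → Δ(i)`: the smallest submodule `U` of `P(i)` such that all
composition factors of `P(i)/U` are of the form `S(j)` with `j ≤ i`. -/
def K (i : I) : Submodule B (D.P i) :=
  sInf {U | ∀ j, IsCompositionFactor (B := B) (D.S j) (D.P i ⧸ U) → j ≤ i}

/-- The standard module `Δ(i) = P(i)/K(i)`: the maximal factor module of `P(i)` all of whose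
composition factors are of the form `S(j)` with `j ≤ i`. -/
def Δ (i : I) : ModuleCat.{u} B := ModuleCat.of B (D.P i ⧸ D.K i)

end SimplesWithCovers

end Modules

/-! ### Right- and left-strongly quasi-hereditary rings -/

/-- `(A, ≤)` is right-strongly quasi-hereditary, where `≤` is a partial order on the set `I` that
indexes the simple right `A`-modules. -/
structure IsRightStronglyQuasiHereditaryFor (A : Type u) [Ring A] {I : Type w} [PartialOrder I]
    (D : SimplesWithCovers Aᵐᵒᵖ I) : Prop where
  /-- `S(i)` occurs in `Δ(i)` only as its top, so the other composition factors are `S(j)`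
  with `j < i`. -/
  multiplicity_one : ∀ i, ¬ IsCompositionFactor (B := Aᵐᵒᵖ) (D.S i)
    (Module.jacobson Aᵐᵒᵖ (D.Δ i))
  /-- `K(i)` has a filtration by standard modules, and only `Δ(j)` with `i < j` occur. -/
  filtration : ∀ i, HasFiltration D.Δ {j | i < j} (D.K i)
  /-- `K(i)` is projective. -/
  projective : ∀ i, Module.Projective Aᵐᵒᵖ (D.K i)

/-- `A` is right-strongly quasi-hereditary (with respect to some partial order on the finite
set of isomorphism classes of simple right modules). -/
def IsRightStronglyQuasiHereditary (A : Type u) [Ring A] : Prop :=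
  ∃ (I : Type) (_ : Finite I) (_ : PartialOrder I) (D : SimplesWithCovers Aᵐᵒᵖ I),
    IsRightStronglyQuasiHereditaryFor A D

/-- `A` is left-strongly quasi-hereditary if the opposite ring is right-strongly
quasi-hereditary. -/
def IsLeftStronglyQuasiHereditary (A : Type u) [Ring A] : Prop :=
  IsRightStronglyQuasiHereditary Aᵐᵒᵖ

/-! ### Rejective subcategories and chains

A full subcategory of `C` is given by the property of objects that defines it. -/

section Rejective

variable {C : Type u} [Category.{v} C]

/-- A full subcategory is right rejective if its inclusion functor has a right adjoint whose
counit is a monomorphism at every object. -/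
def IsRightRejective (D : ObjectProperty C) : Prop :=
  ∃ (G : C ⥤ D.FullSubcategory) (adj : D.ι ⊣ G), ∀ X : C, Mono (adj.counit.app X)

/-- A full subcategory is left rejective if its inclusion functor has a left adjoint whose
unit is an epimorphism at every object. -/
def IsLeftRejective (D : ObjectProperty C) : Prop :=
  ∃ (G : C ⥤ D.FullSubcategory) (adj : G ⊣ D.ι), ∀ X : C, Epi (adj.unit.app X)

/-- `f` belongs to the ideal `[D]` of morphisms that factor through an object of `D`. -/
def FactorsThrough (D : ObjectProperty C) {X Y : C} (f : X ⟶ Y) : Prop :=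
  ∃ Z : C, D Z ∧ ∃ (a : X ⟶ Z) (b : Z ⟶ Y), a ≫ b = f

variable [Preadditive C]

/-- The class of `f` in the factor category modulo the ideal `[D]` is an isomorphism. -/
def IsIsoModulo (D : ObjectProperty C) {X Y : C} (f : X ⟶ Y) : Prop :=
  ∃ h : Y ⟶ X, FactorsThrough D (f ≫ h - 𝟙 X) ∧ FactorsThrough D (h ≫ f - 𝟙 Y)

/-- The class of `f : X ⟶ Y` in the factor category modulo the ideal `[D]` lies in the Jacobson
radical of that category: `1 - g f` is invertible there for all `g : Y ⟶ X`. -/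
def IsRadicalModulo (D : ObjectProperty C) {X Y : C} (f : X ⟶ Y) : Prop :=
  ∀ g : Y ⟶ X, IsIsoModulo D (𝟙 X - f ≫ g)

/-- For full subcategories `D' ⊆ D` of `C`, the subcategory `D'` is cosemisimple in `D`: the factor
category `D/[D']` is semisimple, i.e. its Jacobson radical is zero. -/
def IsCosemisimpleIn (D' D : ObjectProperty C) : Prop :=
  ∀ ⦃X Y : C⦄, D X → D Y → ∀ f : X ⟶ Y, IsRadicalModulo D' f → FactorsThrough D' f

/-- A (strictly decreasing) chain `C = D 0 ⊃ D 1 ⊃ ⋯ ⊃ D n = 0` of full subcategories is a total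
right rejective chain of `C`. -/
structure IsTotalRightRejectiveChain {n : ℕ} (D : Fin (n + 1) → ObjectProperty C) : Prop where
  zero : ∀ X, D 0 X
  last : ∀ X, D (Fin.last n) X ↔ IsZero X
  strictAnti : StrictAnti D
  rejective : ∀ i : Fin n, IsRightRejective (D i.succ)
  cosemisimple : ∀ i : Fin n, IsCosemisimpleIn (D i.succ) (D i.castSucc)

/-- A (strictly decreasing) chain `C = D 0 ⊃ D 1 ⊃ ⋯ ⊃ D n = 0` of full subcategories is a total
left rejective chain of `C`. -/
structure IsTotalLeftRejectiveChain {n : ℕ} (D : Fin (n + 1) → ObjectProperty C) : Prop where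
  zero : ∀ X, D 0 X
  last : ∀ X, D (Fin.last n) X ↔ IsZero X
  strictAnti : StrictAnti D
  rejective : ∀ i : Fin n, IsLeftRejective (D i.succ)
  cosemisimple : ∀ i : Fin n, IsCosemisimpleIn (D i.succ) (D i.castSucc)

end Rejective

/-! ### The category `proj A` and its subcategories `add eA` -/

/-- The category `proj A` of finitely generated projective right `A`-modules. -/
abbrev ProjCat (A : Type u) [Ring A] :=
  ObjectProperty.FullSubcategory (fun M : ModuleCat.{u} Aᵐᵒᵖ ↦
    Module.Finite Aᵐᵒᵖ M ∧ Module.Projective Aᵐᵒᵖ M)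

/-- The subcategory `add eA` of `proj A`: the direct summands of the finite direct sums `(eA)ⁿ`,
where `eA` is the right ideal of `A` generated by `e`. -/
def addIdem {A : Type u} [Ring A] (e : A) : ObjectProperty (ProjCat A) := fun X ↦
  ∃ (n : ℕ) (i : X.obj →ₗ[Aᵐᵒᵖ] (Fin n → Submodule.span Aᵐᵒᵖ ({e} : Set A)))
    (p : (Fin n → Submodule.span Aᵐᵒᵖ ({e} : Set A)) →ₗ[Aᵐᵒᵖ] X.obj),
    p ∘ₗ i = LinearMap.id

end StronglyQH

namespace StronglyQH

/-! ### Trace submodules `B e M` and their projectivity -/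

section Trace

variable {B : Type u} [Ring B] {M : Type v} [AddCommGroup M] [Module B M]
  {N : Type w} [AddCommGroup N] [Module B N]

/-! Right `A`-modules are left modules over `B = Aᵐᵒᵖ`. Global dimension at most two enters through
one consequence: the kernel of a map `Bⁿ → B` is a second syzygy of the cokernel, hence projective
(`KernelsProjective`).

The heart is `KernelsProjective.remove`. Let `J` be the radical, `e` a sum of members of a basic
family of local idempotents, and `B e B` projective. Choose `v ≠ 0` in `e B` with `e J v = 0` and a
summand `f` of `e` with `f v ≠ 0`; replace `v` by `f v` and put `e' = e - f`. The kernel `N` of `B f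
→ B`, `x ↦ x v`, is projective, hence so is `M = B e N`, and `e J f ⊆ M`. The top of `B f` is not a
quotient of `M`: otherwise `B f` would be a summand of `M ⊆ N ⊆ B f`, and an injective endomorphism
of an artinian module is onto, so `f v = 0`. Therefore `M = B e' M`, so `e J f ⊆ B e' B`; also `B e'
B f = M`, which makes `B e' B` projective. Starting from `B e B = B` and iterating orders the local
idempotents `g i` (`KernelsProjective.exists_isRejectiveFamily`).

With `e_k` the sum of the `g i`, `i ≥ k`, one has `K(i) = B e_{i+1} B g_i`. This is projective, a
sum of modules `B g_j` with `j > i`, and so inductively filtered by standard modules; `g_i J g_i ⊆ B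
e_{i+1} B` gives multiplicity one. On projectives, `X ↦ B e_k X` is the right adjoint for `add e_k
A`, and `e_k J e_k ⊆ B e_{k+1} B` gives cosemisimplicity.

For the left-hand statements, `KernelsProjective` passes to the opposite ring by a `Tor` argument
(`KernelsProjective.of_opEquiv`). The left adjoint is induced by the dual `A → Hom(AeA, A)` of the
inclusion of the projective left ideal `AeA`. -/

/-- The submodule `B e N` generated by the elements `e • x`, `x ∈ N`. -/
def trace (e : B) (N : Submodule B M) : Submodule B M :=
  Submodule.span B ((e • ·) '' (N : Set M))

lemma smul_mem_trace (e : B) {N : Submodule B M} {x : M} (hx : x ∈ N) : e • x ∈ trace e N :=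
  Submodule.subset_span ⟨x, hx, rfl⟩

lemma trace_le_iff {e : B} {N L : Submodule B M} : trace e N ≤ L ↔ ∀ x ∈ N, e • x ∈ L := by
  simp [trace, Submodule.span_le, Set.subset_def]

lemma trace_le (e : B) (N : Submodule B M) : trace e N ≤ N :=
  trace_le_iff.2 fun _ hx ↦ N.smul_mem e hx

lemma trace_mono (e : B) {N L : Submodule B M} (h : N ≤ L) : trace e N ≤ trace e L :=
  trace_le_iff.2 fun _ hx ↦ smul_mem_trace e (h hx)

lemma map_trace (e : B) (f : M →ₗ[B] N) (L : Submodule B M) :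
    (trace e L).map f = trace e (L.map f) := by
  simp only [trace, Submodule.map_span, Submodule.map_coe, Set.image_image, map_smul]

lemma map_trace_le (e : B) (f : M →ₗ[B] N) : (trace e (⊤ : Submodule B M)).map f ≤ trace e ⊤ := by
  rw [map_trace]; exact trace_mono e le_top

lemma apply_mem_trace (e : B) (f : M →ₗ[B] N) {x : M} (hx : x ∈ trace e (⊤ : Submodule B M)) :
    f x ∈ trace e (⊤ : Submodule B N) :=
  map_trace_le e f (Submodule.mem_map_of_mem hx)

lemma trace_anti {e e' : B} (h : e' = e * e') (N : Submodule B M) : trace e' N ≤ trace e N :=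
  trace_le_iff.2 fun x hx ↦ by
    rw [h, mul_smul]; exact smul_mem_trace e (N.smul_mem e' hx)

lemma trace_trace {e e' : B} (h : e' = e * e') (N : Submodule B M) (he' : IsIdempotentElem e') :
    trace e' (trace e N) = trace e' N := by
  refine le_antisymm (trace_mono e' (trace_le e N)) (trace_le_iff.2 fun x hx ↦ ?_)
  have h1 := smul_mem_trace e' (trace_anti h N (smul_mem_trace e' hx))
  rwa [smul_smul, he'.eq] at h1

lemma trace_self {e : B} (he : IsIdempotentElem e) (N : Submodule B M) :
    trace e (trace e N) = trace e N :=
  trace_trace he.eq.symm N he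

lemma trace_top_coe (e : B) (L : Submodule B M) :
    (trace e (⊤ : Submodule B L)).map L.subtype = trace e L := by
  rw [map_trace, Submodule.map_top, Submodule.range_subtype]

lemma trace_top_eq_top_iff (e : B) (L : Submodule B M) :
    trace e (⊤ : Submodule B L) = ⊤ ↔ trace e L = L := by
  constructor
  · intro h; rw [← trace_top_coe, h, Submodule.map_top, Submodule.range_subtype]
  · intro h
    apply Submodule.map_injective_of_injective L.subtype_injective
    rw [trace_top_coe, h, Submodule.map_top, Submodule.range_subtype]

lemma projective_trace_coe_iff (e : B) (L : Submodule B M) :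
    Module.Projective B (trace e (⊤ : Submodule B L)) ↔ Module.Projective B (trace e L) := by
  have E : trace e (⊤ : Submodule B L) ≃ₗ[B] trace e L :=
    (Submodule.equivMapOfInjective L.subtype L.subtype_injective _).trans
      (LinearEquiv.ofEq _ _ (trace_top_coe e L))
  exact ⟨fun _ ↦ .of_equiv E, fun _ ↦ .of_equiv E.symm⟩

lemma projective_trace_of_retract (e : B) (i : M →ₗ[B] N) (p : N →ₗ[B] M)
    (h : p ∘ₗ i = LinearMap.id) (hN : Module.Projective B (trace e (⊤ : Submodule B N))) :
    Module.Projective B (trace e (⊤ : Submodule B M)) := by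
  refine .of_split (i.restrict fun _ ↦ apply_mem_trace e i) (p.restrict fun _ ↦ apply_mem_trace e p) ?_
  ext x
  exact LinearMap.congr_fun h x

instance projective_pi {ι : Type*} [Finite ι] (X : ι → Type*) [∀ i, AddCommGroup (X i)]
    [∀ i, Module B (X i)] [∀ i, Module.Projective B (X i)] : Module.Projective B (∀ i, X i) := by
  classical
  cases nonempty_fintype ι
  exact .of_equiv (DirectSum.linearEquivFunOnFintype B ι X)

lemma projective_trace_pi (e : B) {ι : Type*} [Finite ι] (X : ι → Type*) [∀ i, AddCommGroup (X i)]
    [∀ i, Module B (X i)] (h : ∀ i, Module.Projective B (trace e (⊤ : Submodule B (X i)))) :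
    Module.Projective B (trace e (⊤ : Submodule B (∀ i, X i))) := by
  classical
  cases nonempty_fintype ι
  let s : trace e (⊤ : Submodule B (∀ i, X i)) →ₗ[B] ∀ i, trace e (⊤ : Submodule B (X i)) :=
    LinearMap.pi fun i ↦ (LinearMap.proj i).restrict fun _ ↦ apply_mem_trace e _
  let r : (∀ i, trace e (⊤ : Submodule B (X i))) →ₗ[B] trace e (⊤ : Submodule B (∀ i, X i)) :=
    ∑ i, ((LinearMap.single B X i).restrict fun _ ↦ apply_mem_trace e _) ∘ₗ LinearMap.proj i
  refine .of_split s r ?_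
  ext x j
  simp [s, r, LinearMap.restrict_apply]

lemma trace_pi_eq_top (e : B) {ι : Type*} [Finite ι] (X : ι → Type*) [∀ i, AddCommGroup (X i)]
    [∀ i, Module B (X i)] (h : ∀ i, trace e (⊤ : Submodule B (X i)) = ⊤) :
    trace e (⊤ : Submodule B (∀ i, X i)) = ⊤ := by
  classical
  cases nonempty_fintype ι
  refine eq_top_iff.2 fun x _ ↦ ?_
  rw [← Finset.univ_sum_single x]
  refine Submodule.sum_mem _ fun i _ ↦ ?_
  exact apply_mem_trace e (LinearMap.single B X i) ((h i).symm ▸ Submodule.mem_top)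

lemma trace_eq_top_of_surjective (e : B) (f : M →ₗ[B] N) (hf : Function.Surjective f)
    (h : trace e (⊤ : Submodule B M) = ⊤) : trace e (⊤ : Submodule B N) = ⊤ := by
  rw [← LinearMap.range_eq_top] at hf
  rw [← hf, ← Submodule.map_top, ← map_trace, h]

lemma mem_span_singleton_iff_mul {e : B} (he : IsIdempotentElem e) {x : B} :
    x ∈ Submodule.span B ({e} : Set B) ↔ x * e = x := by
  rw [Submodule.mem_span_singleton]
  constructor
  · rintro ⟨a, rfl⟩; rw [smul_eq_mul, mul_assoc, he.eq]
  · intro h; exact ⟨x, h⟩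

lemma trace_span_singleton {e : B} (he : IsIdempotentElem e) :
    trace e (⊤ : Submodule B (Submodule.span B ({e} : Set B))) = ⊤ := by
  rw [trace_top_eq_top_iff]
  refine le_antisymm (trace_le _ _) ((Submodule.span_singleton_le_iff_mem _ _).2 ?_)
  conv => congr; rfl; rw [← he.eq, ← smul_eq_mul]
  exact smul_mem_trace e (Submodule.mem_span_singleton_self e)

/-- A module generated by `e • M` is a quotient of a finite power of `B e`. -/
lemma exists_surjective_of_trace_eq_top [Module.Finite B M] {e : B} (he : IsIdempotentElem e)
    (h : trace e (⊤ : Submodule B M) = ⊤) :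
    ∃ (n : ℕ) (f : (Fin n → Submodule.span B ({e} : Set B)) →ₗ[B] M), Function.Surjective f := by
  classical
  have hfg : (Submodule.span B ((e • ·) '' ((⊤ : Submodule B M) : Set M))).FG := by
    rw [← trace, h]; exact Module.Finite.fg_top
  rw [Submodule.fg_span_iff_fg_span_finset_subset] at hfg
  obtain ⟨s, hs, hs'⟩ := hfg
  rw [← trace, h] at hs'
  refine ⟨s.card, ∑ k, (LinearMap.toSpanSingleton B M (s.equivFin.symm k : M)) ∘ₗ
    (Submodule.subtype _) ∘ₗ LinearMap.proj k, ?_⟩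
  rw [← LinearMap.range_eq_top, eq_top_iff, hs', Submodule.span_le]
  intro x hx
  obtain ⟨y, -, rfl⟩ := hs hx
  refine ⟨Pi.single (s.equivFin ⟨_, hx⟩) ⟨e, Submodule.mem_span_singleton_self e⟩, ?_⟩
  rw [LinearMap.sum_apply, Finset.sum_eq_single (s.equivFin ⟨_, hx⟩)]
  · simp [smul_smul, he.eq]
  · intro k _ hk; simp [hk]
  · simp

lemma exists_retract_of_trace_eq_top [Module.Finite B M] [Module.Projective B M] {e : B}
    (he : IsIdempotentElem e) (h : trace e (⊤ : Submodule B M) = ⊤) :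
    ∃ (n : ℕ) (i : M →ₗ[B] (Fin n → Submodule.span B ({e} : Set B)))
      (p : (Fin n → Submodule.span B ({e} : Set B)) →ₗ[B] M), p ∘ₗ i = LinearMap.id := by
  obtain ⟨n, f, hf⟩ := exists_surjective_of_trace_eq_top he h
  obtain ⟨i, hi⟩ := Module.projective_lifting_property f LinearMap.id hf
  exact ⟨n, i, f, hi⟩

/-- If `B e B` is projective, so is `B e M` for every finitely generated projective `M`. -/
lemma projective_trace [Module.Finite B M] [Module.Projective B M] {e : B}
    (h : Module.Projective B (trace e (⊤ : Submodule B B))) :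
    Module.Projective B (trace e (⊤ : Submodule B M)) := by
  obtain ⟨n, f, hf⟩ := Module.Finite.exists_fin' B M
  obtain ⟨i, hi⟩ := Module.projective_lifting_property f LinearMap.id hf
  exact projective_trace_of_retract e i f hi (projective_trace_pi e _ fun _ ↦ h)

lemma projective_span_singleton {e : B} (he : IsIdempotentElem e) :
    Module.Projective B (Submodule.span B ({e} : Set B)) := by
  refine .of_split (Submodule.subtype _) ((LinearMap.toSpanSingleton B B e).codRestrict _ fun x ↦
    Submodule.smul_mem _ _ (Submodule.mem_span_singleton_self e)) ?_
  ext x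
  exact (mem_span_singleton_iff_mul he).1 x.2

end Trace
end StronglyQH

namespace StronglyQH

/-! ### Local idempotents and their simple tops -/

section LocalIdempotent

variable {B : Type u} [Ring B]

/-- An idempotent `e` outside the radical such that all proper submodules of `B e` lie in the
radical, i.e. `B e` is a local projective module. -/
structure IsLocalIdem (e : B) : Prop where
  idem : IsIdempotentElem e
  notMem : e ∉ Ring.jacobson B
  le_jacobson : ∀ N : Submodule B B, N ≤ Submodule.span B {e} → e ∉ N → N ≤ Ring.jacobson B

/-- The radical of `B e`, as a submodule of `B e`. -/
def radIdem (e : B) : Submodule B (Submodule.span B ({e} : Set B)) :=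
  (Ring.jacobson B).submoduleOf (Submodule.span B {e})

lemma mem_radIdem {e : B} {x : Submodule.span B ({e} : Set B)} :
    x ∈ radIdem e ↔ (x : B) ∈ Ring.jacobson B := Iff.rfl

/-- The generator `e` of `B e`. -/
def genIdem (e : B) : Submodule.span B ({e} : Set B) := ⟨e, Submodule.mem_span_singleton_self e⟩

lemma coe_genIdem (e : B) : (genIdem e : B) = e := rfl

lemma eq_smul_genIdem {e : B} (he : IsIdempotentElem e) (x : Submodule.span B ({e} : Set B)) :
    x = (x : B) • genIdem e :=
  Subtype.ext ((mem_span_singleton_iff_mul he).1 x.2).symm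

lemma smul_genIdem_self {e : B} (he : IsIdempotentElem e) : e • genIdem e = genIdem e :=
  Subtype.ext he.eq

lemma IsLocalIdem.le_radIdem {e : B} (h : IsLocalIdem e)
    {N : Submodule B (Submodule.span B ({e} : Set B))} (hN : N ≠ ⊤) : N ≤ radIdem e := by
  have : N.map (Submodule.subtype _) ≤ Ring.jacobson B := by
    refine h.le_jacobson _ (Submodule.map_subtype_le _ N) fun he ↦ hN ?_
    obtain ⟨y, hy, hye⟩ := he
    have hy' : y = genIdem e := Subtype.ext hye
    rw [eq_top_iff]
    intro x _
    rw [eq_smul_genIdem h.idem x, ← hy']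
    exact N.smul_mem _ hy
  exact Submodule.map_le_iff_le_comap.1 this

lemma IsLocalIdem.radIdem_ne_top {e : B} (h : IsLocalIdem e) : radIdem e ≠ ⊤ := fun ht ↦
  h.notMem (ht ▸ Submodule.mem_top : genIdem e ∈ radIdem e)

lemma IsLocalIdem.isCoatom_radIdem {e : B} (h : IsLocalIdem e) : IsCoatom (radIdem e) :=
  ⟨h.radIdem_ne_top, fun _ hN ↦ by_contra fun hne ↦ hN.not_ge (h.le_radIdem hne)⟩

lemma IsLocalIdem.isSimpleModule {e : B} (h : IsLocalIdem e) :
    IsSimpleModule B (Submodule.span B ({e} : Set B) ⧸ radIdem e) :=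
  isSimpleModule_iff_isCoatom.2 h.isCoatom_radIdem

lemma IsLocalIdem.eq_radIdem {e : B} (h : IsLocalIdem e)
    {N : Submodule B (Submodule.span B ({e} : Set B))} (hN : IsCoatom N) : N = radIdem e :=
  (hN.le_iff.1 (h.le_radIdem hN.1)).resolve_left h.radIdem_ne_top |>.symm

lemma idem_smul_mk_ne_zero {e : B} (h : IsLocalIdem e) :
    e • (Submodule.Quotient.mk (genIdem e) : _ ⧸ radIdem e) ≠ 0 := by
  rw [← Submodule.Quotient.mk_smul, smul_genIdem_self h.idem, Ne, Submodule.Quotient.mk_eq_zero]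
  exact h.notMem

variable {T : Type v} [AddCommGroup T] [Module B T]

/-- The map `B e → T`, `b e ↦ b e t`. -/
def evalIdem (e : B) (t : T) : Submodule.span B ({e} : Set B) →ₗ[B] T :=
  LinearMap.toSpanSingleton B T t ∘ₗ Submodule.subtype _

lemma evalIdem_apply (e : B) (t : T) (x : Submodule.span B ({e} : Set B)) :
    evalIdem e t x = (x : B) • t := rfl

lemma evalIdem_surjective [IsSimpleModule B T] {e : B} {t : T} (ht : e • t ≠ 0) :
    Function.Surjective (evalIdem e t) := by
  refine (LinearMap.surjective_or_eq_zero _).resolve_right fun h ↦ ht ?_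
  simpa [evalIdem_apply, coe_genIdem] using LinearMap.congr_fun h (genIdem e)

lemma IsLocalIdem.ker_eq_radIdem [IsSimpleModule B T] {e : B} (h : IsLocalIdem e)
    {f : Submodule.span B ({e} : Set B) →ₗ[B] T} (hf : Function.Surjective f) :
    LinearMap.ker f = radIdem e :=
  h.eq_radIdem (LinearMap.isCoatom_ker_of_surjective hf)

lemma IsLocalIdem.nonempty_equiv [IsSimpleModule B T] {e : B} (h : IsLocalIdem e)
    {t : T} (ht : e • t ≠ 0) :
    Nonempty ((Submodule.span B ({e} : Set B) ⧸ radIdem e) ≃ₗ[B] T) :=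
  ⟨(Submodule.quotEquivOfEq _ _ (h.ker_eq_radIdem (evalIdem_surjective ht)).symm).trans
    ((evalIdem e t).quotKerEquivOfSurjective (evalIdem_surjective ht))⟩

lemma smul_mk_ne_zero_of_notMem {e e' b : B} (hb : e' * b * e ∉ Ring.jacobson B) :
    e' • (Submodule.Quotient.mk (b • genIdem e) : _ ⧸ radIdem e) ≠ 0 := by
  rw [← Submodule.Quotient.mk_smul, Ne, Submodule.Quotient.mk_eq_zero, mem_radIdem]
  simpa [coe_genIdem, mul_assoc] using hb

lemma exists_smul_ne_zero_of_equiv {T' : Type w} [AddCommGroup T'] [Module B T'] (f : T ≃ₗ[B] T')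
    {e : B} {t : T} (h : e • t ≠ 0) : e • f t ≠ 0 := by
  rw [← map_smul]; exact f.map_ne_zero_iff.2 h

end LocalIdempotent

/-! ### Existence of a basic family of local idempotents -/

section Existence

variable {B : Type u} [Ring B] [IsArtinianRing B]

lemma isNilpotent_of_mem_jacobson {x : B} (hx : x ∈ Ring.jacobson B) : IsNilpotent x := by
  obtain ⟨n, hn⟩ := IsSemiprimaryRing.isNilpotent (R := B)
  refine ⟨n, ?_⟩
  have : x ^ n ∈ Ring.jacobson B ^ n := Ideal.pow_mem_pow hx n
  rwa [hn, Ideal.zero_eq_bot, Ideal.mem_bot] at this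

-- `B ⧸ J` is a direct sum of simple left ideals; the idempotents of this decomposition lift because
-- `J` is nil.
variable (B) in
lemma exists_completeOrthogonalIdempotents_isLocalIdem :
    ∃ (n : ℕ) (h : Fin n → B), CompleteOrthogonalIdempotents h ∧ ∀ i, IsLocalIdem (h i) := by
  classical
  let J := Ring.jacobson B
  obtain ⟨s, hs, hs', hsimple⟩ := IsSemisimpleModule.exists_sSupIndep_sSup_simples_eq_top (B ⧸ J) (B ⧸ J)
  have hfin : s.Finite := WellFoundedGT.finite_of_sSupIndep hs
  have : Fintype s := hfin.fintype
  let V : s → Ideal (B ⧸ J) := fun m ↦ m.1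
  have hint : DirectSum.IsInternal V :=
    DirectSum.isInternal_submodule_of_iSupIndep_of_iSup_eq_top ((sSupIndep_iff _).1 hs)
      (by rw [← sSup_eq_iSup']; exact hs')
  let _ : DirectSum.Decomposition V := hint.chooseDecomposition
  have hV : ∀ i, DirectSum.idempotent V i ∈ V i := fun i ↦ (DirectSum.decompose V 1 i).2
  have hV' : ∀ i, ∀ x ∈ V i, x * DirectSum.idempotent V i = x := fun i x hx ↦ by
    rw [← DirectSum.decompose_eq_mul_idempotent, DirectSum.decompose_of_mem_same _ hx]
  obtain ⟨h, hh, hcomp⟩ := CompleteOrthogonalIdempotents.lift_of_isNilpotent_ker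
    (Ideal.Quotient.mk J) (fun x hx ↦ isNilpotent_of_mem_jacobson
      (by rwa [Ideal.mk_ker] at hx)) (DirectSum.completeOrthogonalIdempotents_idempotent V)
    (fun i ↦ Ideal.Quotient.mk_surjective _)
  have hmk : ∀ i, Ideal.Quotient.mk J (h i) = DirectSum.idempotent V i := fun i ↦ congr_fun hcomp i
  have hloc : ∀ i, IsLocalIdem (h i) := by
    intro i
    have hsi : IsSimpleModule (B ⧸ J) (V i) := hsimple _ i.2
    refine ⟨hh.idem i, fun hi ↦ ?_, fun N hN hi ↦ ?_⟩
    · have h0 := hmk i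
      rw [Ideal.Quotient.eq_zero_iff_mem.2 hi] at h0
      have := IsSimpleModule.nontrivial (B ⧸ J) (V i)
      obtain ⟨x, hx⟩ := exists_ne (0 : V i)
      exact hx (Subtype.ext (by rw [← hV' i x x.2, ← h0, mul_zero]; rfl))
    · intro x hx
      by_contra hxJ
      have hxe : x * h i = x := (mem_span_singleton_iff_mul (hh.idem i)).1 (hN hx)
      have hxV : Ideal.Quotient.mk J x ∈ V i := by
        rw [← hxe, map_mul, hmk]; exact (V i).mul_mem_left _ (hV i)
      have hx0 : (⟨_, hxV⟩ : V i) ≠ 0 := fun h0 ↦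
        hxJ (Ideal.Quotient.eq_zero_iff_mem.1 (congr_arg Subtype.val h0))
      have hspan := IsSimpleModule.span_singleton_eq_top (B ⧸ J) hx0
      have hmem : (⟨_, hV i⟩ : V i) ∈ Submodule.span (B ⧸ J) {(⟨_, hxV⟩ : V i)} := by
        rw [hspan]; trivial
      obtain ⟨b, hb⟩ := Submodule.mem_span_singleton.1 hmem
      obtain ⟨b, rfl⟩ := Ideal.Quotient.mk_surjective b
      have hb' : Ideal.Quotient.mk J (b * x) = Ideal.Quotient.mk J (h i) := by
        rw [hmk, map_mul]; exact congr_arg Subtype.val hb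
      have hj : h i - b * x ∈ J := by
        rw [← Ideal.Quotient.eq_zero_iff_mem, map_sub, hb', sub_self]
      -- The unit is `u = 1 - (h i - b x)`; since `x h_i = x`, it satisfies `u h_i = b x`, which
      -- puts `h i` into `N`.
      obtain ⟨u, hu⟩ := (isNilpotent_of_mem_jacobson hj).isUnit_one_sub
      apply hi
      have h1 : (u : B) * h i = b * x := by
        rw [hu, sub_mul, one_mul, sub_mul, (hh.idem i).eq, mul_assoc, hxe, sub_sub_cancel]
      have h2 : h i = (↑u⁻¹ : B) * (b * x) := by rw [← h1, Units.inv_mul_cancel_left]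
      rw [h2]
      exact N.smul_mem _ (N.smul_mem b hx)
  let E := Fintype.equivFin s
  exact ⟨_, h ∘ E.symm, (CompleteOrthogonalIdempotents.equiv E.symm).2 hh, fun i ↦ hloc _⟩

/-- Orthogonal local idempotents `g i` such that the modules `B (g i)` represent the isomorphism
classes of indecomposable projective modules. -/
structure IsBasicFamily {n : ℕ} (g : Fin n → B) : Prop where
  ortho : OrthogonalIdempotents g
  isLocal : ∀ i, IsLocalIdem (g i)
  mul_mem : ∀ i j, i ≠ j → ∀ b, g j * b * g i ∈ Ring.jacobson B
  full : ∀ N : Submodule B B, (∀ i b, g i * b ∈ N) → N = ⊤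

-- Keep one idempotent for each isomorphism class of tops. An element `g_j b g_i` outside the
-- radical would make `g_j` act nontrivially on the top of `B g_i` and so identify the two tops.
-- Fullness holds because every simple quotient of `B` is the top of a chosen module.
variable (B) in
lemma exists_isBasicFamily : ∃ (n : ℕ) (g : Fin n → B), IsBasicFamily g := by
  classical
  obtain ⟨r, h, hh, hloc⟩ := exists_completeOrthogonalIdempotents_isLocalIdem B
  let st : Setoid (Fin r) :=
    { r := fun i j ↦ Nonempty ((Submodule.span B ({h i} : Set B) ⧸ radIdem (h i)) ≃ₗ[B]
        (Submodule.span B ({h j} : Set B) ⧸ radIdem (h j)))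
      iseqv := ⟨fun _ ↦ ⟨.refl _ _⟩, fun ⟨f⟩ ↦ ⟨f.symm⟩, fun ⟨f⟩ ⟨f'⟩ ↦ ⟨f.trans f'⟩⟩ }
  have : Fintype (Quotient st) := Fintype.ofFinite _
  let E := Fintype.equivFin (Quotient st)
  let c : Fin (Fintype.card (Quotient st)) → Fin r := fun k ↦ (E.symm k).out
  have hc : Function.Injective c := fun k l hkl ↦ E.symm.injective (Quotient.out_injective hkl)
  have hsimp : ∀ i, IsSimpleModule B (Submodule.span B ({h i} : Set B) ⧸ radIdem (h i)) :=
    fun i ↦ (hloc i).isSimpleModule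
  refine ⟨_, h ∘ c, hh.1.embedding ⟨c, hc⟩, fun i ↦ hloc _, fun i j hij b ↦ ?_, fun N hN ↦ ?_⟩
  · by_contra hb
    have hne := smul_mk_ne_zero_of_notMem hb
    have := hsimp (c i)
    obtain ⟨f⟩ := (hloc (c j)).nonempty_equiv (T := _ ⧸ radIdem (h (c i))) hne
    apply hij
    have : (E.symm i) = (E.symm j) := by
      rw [← Quotient.out_eq (E.symm i), ← Quotient.out_eq (E.symm j)]
      exact Quotient.sound (s := st) ⟨f.symm⟩
    exact E.symm.injective this
  · by_contra hne
    obtain ⟨N', hN', hle⟩ := (eq_top_or_exists_le_coatom N).resolve_left hne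
    have hT : IsSimpleModule B (B ⧸ N') := isSimpleModule_iff_isCoatom.2 hN'
    obtain ⟨j, hj⟩ : ∃ j, h j • (Submodule.Quotient.mk (1 : B) : B ⧸ N') ≠ 0 := by
      by_contra! h0
      have h1 : (1 : B) • (Submodule.Quotient.mk (1 : B) : B ⧸ N') = 0 := by
        generalize (Submodule.Quotient.mk (1 : B) : B ⧸ N') = t at h0 ⊢
        rw [← hh.complete, Finset.sum_smul]
        exact Finset.sum_eq_zero fun j _ ↦ h0 j
      rw [one_smul, Submodule.Quotient.mk_eq_zero] at h1
      exact hN'.1 ((Ideal.eq_top_iff_one _).2 h1)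
    obtain ⟨f⟩ := (hloc j).nonempty_equiv hj
    have hk : c (E ⟦j⟧) ≈ j := by
      apply Quotient.exact
      simp [c]
    obtain ⟨f'⟩ := hk
    have h2 := exists_smul_ne_zero_of_equiv (f'.trans f) (idem_smul_mk_ne_zero (hloc (c (E ⟦j⟧))))
    obtain ⟨b, hb⟩ := Submodule.Quotient.mk_surjective _ ((f'.trans f)
      (Submodule.Quotient.mk (genIdem (h (c (E ⟦j⟧))))))
    rw [← hb, ← Submodule.Quotient.mk_smul, Ne, Submodule.Quotient.mk_eq_zero] at h2
    exact h2 (hle (hN _ b))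

end Existence
end StronglyQH

namespace StronglyQH

/-! ### Removing local idempotents while keeping `B e B` projective -/

section Core

/-- Kernels of linear maps `Bⁿ → B` are projective. -/
def KernelsProjective (B : Type u) [Ring B] : Prop :=
  ∀ (n : ℕ) (f : (Fin n → B) →ₗ[B] B), Module.Projective B (LinearMap.ker f)

variable {B : Type u} [Ring B]

lemma projective_trace_prod (e : B) {M : Type v} [AddCommGroup M] [Module B M]
    {N : Type w} [AddCommGroup N] [Module B N]
    (hM : Module.Projective B (trace e (⊤ : Submodule B M)))
    (hN : Module.Projective B (trace e (⊤ : Submodule B N))) :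
    Module.Projective B (trace e (⊤ : Submodule B (M × N))) := by
  let s : trace e (⊤ : Submodule B (M × N)) →ₗ[B]
      trace e (⊤ : Submodule B M) × trace e (⊤ : Submodule B N) :=
    ((LinearMap.fst B M N).restrict fun _ ↦ apply_mem_trace e _).prod
      ((LinearMap.snd B M N).restrict fun _ ↦ apply_mem_trace e _)
  let r : trace e (⊤ : Submodule B M) × trace e (⊤ : Submodule B N) →ₗ[B]
      trace e (⊤ : Submodule B (M × N)) :=
    ((LinearMap.inl B M N).restrict fun _ ↦ apply_mem_trace e _).coprod
      ((LinearMap.inr B M N).restrict fun _ ↦ apply_mem_trace e _)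
  refine .of_split s r ?_
  ext x <;> simp [s, r, LinearMap.restrict_apply]

/-- Right multiplication by `f` retracts the kernel of `x ↦ x v` on `B` onto its intersection with
`B f`, because `f v = v`. -/
lemma KernelsProjective.projective_inf (hK : KernelsProjective B) {f v : B}
    (hf : IsIdempotentElem f) (hv : f * v = v) :
    Module.Projective B
      ↥(Submodule.span B {f} ⊓ LinearMap.ker (LinearMap.toSpanSingleton B B v)) := by
  let φ : (Fin 1 → B) →ₗ[B] B := LinearMap.toSpanSingleton B B v ∘ₗ LinearMap.proj 0
  have := hK 1 φ
  refine .of_split (M := LinearMap.ker φ)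
    (LinearMap.codRestrict _ (LinearMap.pi (fun _ ↦ Submodule.subtype _)) fun x ↦ ?_)
    (LinearMap.codRestrict _ (LinearMap.toSpanSingleton B B f ∘ₗ LinearMap.proj 0 ∘ₗ
      Submodule.subtype _) fun x ↦ ?_) ?_
  · simpa [φ] using x.2.2
  · have hx := x.2
    simp only [φ, LinearMap.mem_ker, LinearMap.comp_apply, LinearMap.proj_apply,
      LinearMap.toSpanSingleton_apply, smul_eq_mul] at hx
    refine ⟨Submodule.smul_mem _ _ (Submodule.mem_span_singleton_self f), ?_⟩
    change (x : Fin 1 → B) 0 * f * v = 0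
    rw [mul_assoc, hv]
    exact hx
  · ext x
    exact (mem_span_singleton_iff_mul hf).1 x.2.1

lemma IsBasicFamily.ne_zero {n : ℕ} {g : Fin n → B} (hg : IsBasicFamily g) (i : Fin n) :
    g i ≠ 0 := fun h ↦ (hg.isLocal i).notMem (h ▸ zero_mem _)

/-- The sum of the `g i` with `k ≤ i`. -/
def tailSum {n : ℕ} (g : Fin n → B) (k : ℕ) : B := ∑ i with k ≤ i.val, g i

lemma IsBasicFamily.comp_perm {n : ℕ} {g : Fin n → B} (hg : IsBasicFamily g)
    (σ : Equiv.Perm (Fin n)) : IsBasicFamily (g ∘ σ) where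
  ortho := (OrthogonalIdempotents.equiv σ).2 hg.ortho
  isLocal i := hg.isLocal _
  mul_mem i j hij b := hg.mul_mem _ _ (σ.injective.ne hij) b
  full N hN := hg.full N fun i b ↦ by simpa using hN (σ.symm i) b

lemma IsBasicFamily.trace_tailSum_zero {n : ℕ} {g : Fin n → B} (hg : IsBasicFamily g) :
    trace (tailSum g 0) (⊤ : Submodule B B) = ⊤ := by
  refine hg.full _ fun i b ↦ ?_
  refine trace_anti (e' := g i) ?_ ⊤ (smul_mem_trace (g i) (x := b) trivial)
  rw [tailSum, Finset.sum_mul, Finset.sum_eq_single i]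
  · exact (hg.ortho.idem i).eq.symm
  · intro j _ hj; exact hg.ortho.ortho hj
  · simp

lemma tailSum_comp_swap {n : ℕ} (g : Fin n → B) {k l : Fin n} (hkl : k ≤ l) {j : ℕ} (hj : j ≤ k) :
    tailSum (g ∘ Equiv.swap k l) j = tailSum g j := by
  refine Finset.sum_equiv (Equiv.swap k l) (fun i ↦ ?_) fun i _ ↦ rfl
  simp only [Finset.mem_filter, Finset.mem_univ, true_and]
  have hkl' : k.val ≤ l.val := hkl
  rcases eq_or_ne i k with rfl | hik
  · rw [Equiv.swap_apply_left]; omega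
  rcases eq_or_ne i l with rfl | hil
  · rw [Equiv.swap_apply_right]; omega
  rw [Equiv.swap_apply_of_ne_of_ne hik hil]

lemma tailSum_of_le {n : ℕ} (g : Fin n → B) {k : ℕ} (hk : n ≤ k) : tailSum g k = 0 := by
  rw [tailSum, Finset.filter_false_of_mem, Finset.sum_empty]
  intro i _
  have := i.2
  omega

variable [IsArtinianRing B]

/-- If no such `v` existed, then starting from `e` one could multiply repeatedly by elements of `e
J` and find nonzero elements in every power of the nilpotent ideal `J`. -/
lemma exists_jacobson_annihilated {e : B} (he : IsIdempotentElem e) (he0 : e ≠ 0) :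
    ∃ v ≠ 0, e * v = v ∧ ∀ a ∈ Ring.jacobson B, e * a * v = 0 := by
  by_contra! h
  have key : ∀ k : ℕ, ∃ v ∈ Ring.jacobson B ^ k, v ≠ 0 ∧ e * v = v := by
    intro k
    induction k with
    | zero => exact ⟨e, by rw [Submodule.pow_zero, Ideal.one_eq_top]; trivial, he0, he.eq⟩
    | succ k ih =>
      obtain ⟨v, hv, hv0, hev⟩ := ih
      obtain ⟨a, ha, hav⟩ := h v hv0 hev
      refine ⟨e * a * v, ?_, hav, by rw [← mul_assoc, ← mul_assoc, he.eq]⟩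
      rw [Ideal.IsTwoSided.pow_succ]
      exact Ideal.mul_mem_mul (Ideal.mul_mem_left _ _ ha) hv
  obtain ⟨n, hn⟩ := IsSemiprimaryRing.isNilpotent (R := B)
  obtain ⟨v, hv, hv0, -⟩ := key n
  rw [hn] at hv
  exact hv0 hv

/-- Removing from `e` a local idempotent `f` whose top occurs in the socle of `B e` relative to
`e`. -/
lemma KernelsProjective.remove (hK : KernelsProjective B) {e e' f v : B} (he : IsIdempotentElem e)
    (he' : IsIdempotentElem e') (hf : IsLocalIdem f) (hsum : e = e' + f) (hef : e' * f = 0)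
    (hfe : f * e' = 0) (hP : Module.Projective B (trace e (⊤ : Submodule B B)))
    (hmem : ∀ b, e' * b * f ∈ Ring.jacobson B) (hv0 : v ≠ 0) (hv : f * v = v)
    (hJ : ∀ a ∈ Ring.jacobson B, e * a * v = 0) :
    Module.Projective B (trace e' (⊤ : Submodule B B)) ∧
      ∀ a ∈ Ring.jacobson B, e * a * f ∈ trace e' (⊤ : Submodule B B) := by
  have hee' : e * e' = e' := by rw [hsum, add_mul, he'.eq, hfe, add_zero]
  have he'e : e' * e = e' := by rw [hsum, mul_add, he'.eq, hef, add_zero]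
  have hff := hf.idem
  set N : Submodule B B := Submodule.span B {f} ⊓ LinearMap.ker (LinearMap.toSpanSingleton B B v)
    with hN
  have memN : ∀ x, x ∈ N ↔ x * f = x ∧ x * v = 0 := fun x ↦ by
    rw [hN, Submodule.mem_inf, mem_span_singleton_iff_mul hff]; rfl
  have hNproj : Module.Projective B N := hK.projective_inf hff hv
  have hfN : f ∉ N := fun h ↦ hv0 (by rw [← hv]; exact ((memN f).1 h).2)
  set M := trace e N with hM
  have hMproj : Module.Projective B M :=
    (projective_trace_coe_iff e N).1 (projective_trace hP)
  have memM : ∀ x, e * x = x → x ∈ N → x ∈ M := fun x hx hxN ↦ by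
    rw [← hx]; exact smul_mem_trace e hxN
  -- Otherwise `M` has a simple quotient killed by `e'`. As `M` is generated by `e M`, this quotient
  -- is not killed by `f`, so it is the top of `B f`.
  have hM' : trace e' M = M := by
    rw [← trace_top_eq_top_iff]
    by_contra hne
    obtain ⟨C, hC, hle⟩ := (eq_top_or_exists_le_coatom _).resolve_left hne
    have hT : IsSimpleModule B (M ⧸ C) := isSimpleModule_iff_isCoatom.2 hC
    have he'T : ∀ t : M ⧸ C, e' • t = 0 := fun t ↦ by
      obtain ⟨x, rfl⟩ := Submodule.Quotient.mk_surjective _ t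
      rw [← Submodule.Quotient.mk_smul, Submodule.Quotient.mk_eq_zero]
      exact hle (smul_mem_trace e' trivial)
    obtain ⟨t, ht⟩ : ∃ t : M ⧸ C, f • t ≠ 0 := by
      by_contra! h0
      apply hC.1
      rw [eq_top_iff, ← (trace_top_eq_top_iff e M).2 (trace_self he N), trace_le_iff]
      intro x _
      rw [← Submodule.Quotient.mk_eq_zero, Submodule.Quotient.mk_smul, hsum, add_smul, he'T, h0,
        add_zero]
    -- `M` is projective, so `M → M ⧸ C` lifts through `B f`; the lift is onto because `B f` is
    -- local, and then splits. The section gives an injective endomorphism of `B f` with image in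
    -- `N`, forcing `f ∈ N`.
    obtain ⟨φ, hφ⟩ := Module.projective_lifting_property (evalIdem f t) C.mkQ
      (evalIdem_surjective ht)
    have hφs : Function.Surjective φ := by
      rw [← LinearMap.range_eq_top]
      by_contra hr
      have h1 := hf.le_radIdem hr
      rw [← hf.ker_eq_radIdem (evalIdem_surjective ht), LinearMap.range_le_ker_iff, hφ] at h1
      apply hC.1
      rw [← C.ker_mkQ, h1, LinearMap.ker_zero]
    have : Module.Projective B (Submodule.span B ({f} : Set B)) := projective_span_singleton hff
    obtain ⟨σ, hσ⟩ := Module.projective_lifting_property φ LinearMap.id hφs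
    have hMf : M ≤ Submodule.span B {f} := (trace_le e N).trans inf_le_left
    have hinj : Function.Injective (Submodule.inclusion hMf ∘ₗ σ) :=
      (Submodule.inclusion_injective hMf).comp
        (Function.LeftInverse.injective (g := φ) fun x ↦ LinearMap.congr_fun hσ x)
    obtain ⟨x, hx⟩ := IsArtinian.surjective_of_injective_endomorphism _ hinj (genIdem f)
    have : f = (σ x : B) := (congr_arg Subtype.val hx).symm
    exact hfN (this ▸ trace_le e N (σ x).2)
  have hJM : ∀ a ∈ Ring.jacobson B, e * a * f ∈ M := fun a ha ↦ by
    refine memM _ (by rw [← mul_assoc, ← mul_assoc, he.eq]) ((memN _).2 ⟨?_, ?_⟩)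
    · rw [mul_assoc, hff.eq]
    · rw [mul_assoc, hv, hJ a ha]
  refine ⟨?_, fun a ha ↦ trace_mono e' le_top (hM' ▸ hJM a ha)⟩
  -- For `x ∈ B f`, the element `e' x = e (e' x f) f` lies in `e J f ⊆ M`, by `hmem` and `hJM`.
  have htf : trace e' (Submodule.span B {f}) = M := by
    refine le_antisymm (trace_le_iff.2 fun x hx ↦ ?_) ?_
    · have hx' : x * f = x := (mem_span_singleton_iff_mul hff).1 hx
      have h1 := hJM _ (hmem x)
      rwa [← mul_assoc, ← mul_assoc, hee', mul_assoc _ f f, hff.eq, mul_assoc, hx'] at h1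
    · rw [← hM']
      exact trace_mono e' ((trace_le e N).trans inf_le_left)
  have hBe' : Module.Projective B
      (trace e' (⊤ : Submodule B (Submodule.span B ({e'} : Set B)))) := by
    rw [trace_span_singleton he']
    have := projective_span_singleton he'
    exact .of_equiv Submodule.topEquiv.symm
  have hBf : Module.Projective B
      (trace e' (⊤ : Submodule B (Submodule.span B ({f} : Set B)))) := by
    rw [projective_trace_coe_iff, htf]; exact hMproj
  have hBe : Module.Projective B
      (trace e' (⊤ : Submodule B (Submodule.span B ({e} : Set B)))) := by
    let q : (Submodule.span B ({e'} : Set B) × Submodule.span B ({f} : Set B)) →ₗ[B] B :=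
      (Submodule.subtype _).coprod (Submodule.subtype _)
    have hq : ∀ c, q c ∈ Submodule.span B {e} := by
      rintro ⟨⟨x, hx⟩, ⟨y, hy⟩⟩
      rw [mem_span_singleton_iff_mul he'] at hx
      rw [mem_span_singleton_iff_mul hff] at hy
      rw [mem_span_singleton_iff_mul he]
      change (x + y) * e = x + y
      have h1 : x * e = x := by rw [← hx, mul_assoc, he'e]
      have h2 : y * e = y := by rw [← hy, mul_assoc, hsum, mul_add, hfe, hff.eq, zero_add]
      rw [add_mul, h1, h2]
    refine projective_trace_of_retract e'
      ((evalIdem e (genIdem e')).prod (evalIdem e (genIdem f))) (q.codRestrict _ hq) ?_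
      (projective_trace_prod e' hBe' hBf)
    ext x
    change (x : B) * e' + (x : B) * f = x
    rw [← mul_add, ← hsum]
    exact (mem_span_singleton_iff_mul he).1 x.2
  -- `B e' B` is the `e'`-trace of `B e B`, a retract of a power of `B e`; so the projectivity of `B
  -- e' B e` suffices.
  rw [← trace_trace hee'.symm ⊤ he', ← projective_trace_coe_iff]
  obtain ⟨r, i, p, hip⟩ := exists_retract_of_trace_eq_top he
    ((trace_top_eq_top_iff e (trace e (⊤ : Submodule B B))).2 (trace_self he _))
  exact projective_trace_of_retract e' i p hip (projective_trace_pi e' _ fun _ ↦ hBe)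

lemma IsBasicFamily.exists_remove {n : ℕ} {g : Fin n → B} (hg : IsBasicFamily g)
    (hK : KernelsProjective B) (s : Finset (Fin n)) (hs : s.Nonempty)
    (hP : Module.Projective B (trace (∑ i ∈ s, g i) (⊤ : Submodule B B))) :
    ∃ i ∈ s, Module.Projective B (trace (∑ j ∈ s.erase i, g j) (⊤ : Submodule B B)) ∧
      ∀ a ∈ Ring.jacobson B,
        (∑ j ∈ s, g j) * a * g i ∈ trace (∑ j ∈ s.erase i, g j) (⊤ : Submodule B B) := by
  set e := ∑ i ∈ s, g i with he_def
  have he : IsIdempotentElem e := hg.ortho.isIdempotentElem_sum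
  have he0 : e ≠ 0 := fun h0 ↦ by
    obtain ⟨i, hi⟩ := hs
    apply hg.ne_zero i
    rw [← hg.ortho.mul_sum_of_mem hi, ← he_def, h0, mul_zero]
  obtain ⟨v, hv0, hev, hv⟩ := exists_jacobson_annihilated he he0
  obtain ⟨i, hi, hgi⟩ : ∃ i ∈ s, g i * v ≠ 0 := by
    by_contra! h0
    apply hv0
    rw [← hev, he_def, Finset.sum_mul]
    exact Finset.sum_eq_zero h0
  have hsum : e = ∑ j ∈ s.erase i, g j + g i := (Finset.sum_erase_add s g hi).symm
  refine ⟨i, hi, hK.remove (v := g i * v) he hg.ortho.isIdempotentElem_sum (hg.isLocal i) hsum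
    ?_ (hg.ortho.mul_sum_of_notMem (Finset.notMem_erase i s)) hP ?_ hgi ?_ ?_⟩
  · rw [Finset.sum_mul]
    exact Finset.sum_eq_zero fun j hj ↦ hg.ortho.ortho (Finset.ne_of_mem_erase hj)
  · intro b
    rw [Finset.sum_mul, Finset.sum_mul]
    exact Submodule.sum_mem _ fun j hj ↦ hg.mul_mem _ _ (Finset.ne_of_mem_erase hj).symm b
  · rw [← mul_assoc, (hg.ortho.idem i).eq]
  · intro a ha
    rw [← mul_assoc, mul_assoc e]
    exact hv _ (Ideal.mul_mem_right _ _ ha)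

/-- A basic family ordered so that the idempotents `tailSum g k` give a rejective chain. -/
structure IsRejectiveFamily {n : ℕ} (g : Fin n → B) : Prop extends IsBasicFamily g where
  projective : ∀ k, Module.Projective B (trace (tailSum g k) (⊤ : Submodule B B))
  mul_mem_trace : ∀ i : Fin n, ∀ a ∈ Ring.jacobson B,
    tailSum g i * a * g i ∈ trace (tailSum g (i + 1)) (⊤ : Submodule B B)

/-- At stage `k` the idempotent to be removed is swapped into position `k`. The swap moves only
positions at least `k`, so it leaves the tail sums up to `k`, and with them the earlier conditions,
unchanged. -/
lemma exists_isRejectiveFamily_aux (hK : KernelsProjective B) {n : ℕ} {g : Fin n → B}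
    (hg : IsBasicFamily g) (k : ℕ) (hk : k ≤ n) : ∃ g : Fin n → B, IsBasicFamily g ∧
      (∀ j ≤ k, Module.Projective B (trace (tailSum g j) (⊤ : Submodule B B))) ∧
      ∀ i : Fin n, i.val < k → ∀ a ∈ Ring.jacobson B,
        tailSum g i * a * g i ∈ trace (tailSum g (i + 1)) (⊤ : Submodule B B) := by
  induction k with
  | zero =>
    refine ⟨g, hg, fun j hj ↦ ?_, fun i hi ↦ absurd hi (Nat.not_lt_zero _)⟩
    rw [Nat.le_zero.1 hj, hg.trace_tailSum_zero]
    exact .of_equiv Submodule.topEquiv.symm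
  | succ k ih =>
    obtain ⟨g, hg, h1, h2⟩ := ih (by omega)
    let k' : Fin n := ⟨k, hk⟩
    obtain ⟨l, hl, hlP, hlJ⟩ := hg.exists_remove hK (Finset.univ.filter fun i ↦ k ≤ i.val)
      ⟨k', by simp [k']⟩ (h1 k le_rfl)
    have hkl' : k ≤ l.val := by simpa using hl
    have hkl : k' ≤ l := hkl'
    have hlast : tailSum (g ∘ Equiv.swap k' l) (k + 1) =
        ∑ j ∈ (Finset.univ.filter fun i : Fin n ↦ k ≤ i.val).erase l, g j := by
      have h3 := tailSum_comp_swap g hkl (le_refl k)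
      have h4 : (Finset.univ.filter fun i : Fin n ↦ k ≤ i.val) =
          insert k' (Finset.univ.filter fun i : Fin n ↦ k + 1 ≤ i.val) := by
        ext i
        simp only [Finset.mem_filter, Finset.mem_univ, true_and, Finset.mem_insert, k', Fin.ext_iff]
        omega
      rw [tailSum, h4, Finset.sum_insert (by simp [k']), tailSum,
        ← Finset.add_sum_erase _ g hl] at h3
      rw [Function.comp_apply, Equiv.swap_apply_left] at h3
      exact add_left_cancel h3
    refine ⟨_, hg.comp_perm (Equiv.swap k' l), fun j hj ↦ ?_, fun i hi a ha ↦ ?_⟩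
    · rcases Nat.lt_or_eq_of_le hj with hj | rfl
      · rw [tailSum_comp_swap g hkl (Nat.lt_succ_iff.1 hj)]
        exact h1 j (Nat.lt_succ_iff.1 hj)
      · rw [hlast]; exact hlP
    · rcases Nat.lt_or_eq_of_le (Nat.lt_succ_iff.1 hi) with hi | hi
      · rw [tailSum_comp_swap g hkl hi.le, tailSum_comp_swap g hkl (Nat.succ_le_of_lt hi),
          Function.comp_apply, Equiv.swap_apply_of_ne_of_ne]
        · exact h2 i hi a ha
        · rintro rfl; exact lt_irrefl _ hi
        · rintro rfl; omega
      · obtain rfl : i = k' := Fin.ext hi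
        rw [hlast, tailSum_comp_swap g hkl le_rfl, Function.comp_apply, Equiv.swap_apply_left]
        exact hlJ a ha

lemma KernelsProjective.exists_isRejectiveFamily (hK : KernelsProjective B) :
    ∃ (n : ℕ) (g : Fin n → B), IsRejectiveFamily g := by
  obtain ⟨n, g, hg⟩ := exists_isBasicFamily B
  obtain ⟨g, hg, h1, h2⟩ := exists_isRejectiveFamily_aux hK hg n le_rfl
  refine ⟨n, g, hg, fun k ↦ ?_, fun i ↦ h2 i i.2⟩
  rcases le_total k n with hk | hk
  · exact h1 k hk
  · rw [tailSum_of_le g hk, ← tailSum_of_le g le_rfl]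
    exact h1 n le_rfl

end Core
end StronglyQH

namespace StronglyQH

/-! ### Projective covers by sums of the modules `B g_i` -/

section Cover

variable {B : Type u} [Ring B]

lemma IsBasicFamily.exists_equiv {n : ℕ} {g : Fin n → B} (hg : IsBasicFamily g)
    (T : Type v) [AddCommGroup T] [Module B T] [IsSimpleModule B T] :
    ∃ i, Nonempty ((Submodule.span B ({g i} : Set B) ⧸ radIdem (g i)) ≃ₗ[B] T) := by
  by_contra! h
  have h0 : ∀ i (t : T), g i • t = 0 := fun i t ↦ by
    by_contra hne
    exact (h i).elim ((hg.isLocal i).nonempty_equiv hne).some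
  have := IsSimpleModule.nontrivial B T
  obtain ⟨t, ht⟩ := exists_ne (0 : T)
  have h1 := hg.full (LinearMap.ker (LinearMap.toSpanSingleton B T t)) fun i b ↦ by
    rw [LinearMap.mem_ker, LinearMap.toSpanSingleton_apply, mul_smul, h0]
  have h2 : (1 : B) ∈ LinearMap.ker (LinearMap.toSpanSingleton B T t) := h1 ▸ trivial
  rw [LinearMap.mem_ker, LinearMap.toSpanSingleton_apply, one_smul] at h2
  exact ht h2

/-- A form of Nakayama's lemma: every maximal submodule contains the radical. -/
lemma range_eq_top_of_jacobson {M : Type v} [AddCommGroup M] [Module B M]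
    [IsCoatomic (Submodule B M)] (N : Submodule B M)
    (h : N.map (Module.jacobson B M).mkQ = ⊤) : N = ⊤ := by
  refine (eq_top_or_exists_le_coatom N).resolve_right fun ⟨C, hC, hle⟩ ↦ hC.1 ?_
  rw [eq_top_iff]
  intro x _
  obtain ⟨y, hy, hyx⟩ : (Module.jacobson B M).mkQ x ∈ N.map (Module.jacobson B M).mkQ := h ▸ trivial
  have h1 : x - y ∈ Module.jacobson B M := by
    rw [← Submodule.ker_mkQ (Module.jacobson B M), LinearMap.mem_ker, map_sub, hyx, sub_self]
  have h2 : x - y ∈ C := (sInf_le hC : Module.jacobson B M ≤ C) h1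
  simpa using C.add_mem h2 (hle hy)

/-- Decompose the semisimple module `M ⧸ rad M` into simples, cover each by its `B g_i`, and lift to
`M`. The kernel is radical because each component already dies in the corresponding top. -/
lemma IsBasicFamily.exists_cover [IsArtinianRing B] {n : ℕ} {g : Fin n → B}
    (hg : IsBasicFamily g) (M : Type v) [AddCommGroup M] [Module B M] [Module.Finite B M] :
    ∃ (r : ℕ) (c : Fin r → Fin n) (φ : (∀ k, Submodule.span B ({g (c k)} : Set B)) →ₗ[B] M),
      Function.Surjective φ ∧ ∀ x, φ x = 0 → ∀ k, x k ∈ radIdem (g (c k)) := by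
  have hss : IsSemisimpleModule B (M ⧸ Module.jacobson B M) :=
    (IsArtinian.isSemisimpleModule_iff_jacobson B _).2 (Module.jacobson_quotient_jacobson B M)
  obtain ⟨r, S, E, hS⟩ :=
    IsSemisimpleModule.exists_linearEquiv_fin_dfinsupp B (M ⧸ Module.jacobson B M)
  have h1 : ∀ k, ∃ i, Nonempty ((Submodule.span B ({g i} : Set B) ⧸ radIdem (g i)) ≃ₗ[B] S k) :=
    fun k ↦ by have := hS k; exact hg.exists_equiv (S k)
  choose c hc using h1
  let f : ∀ k, Submodule.span B ({g (c k)} : Set B) →ₗ[B] S k :=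
    fun k ↦ (hc k).some.toLinearMap ∘ₗ (radIdem (g (c k))).mkQ
  have hf : ∀ k, Function.Surjective (f k) := fun k ↦
    (hc k).some.surjective.comp (Submodule.mkQ_surjective _)
  let E' : (M ⧸ Module.jacobson B M) ≃ₗ[B] (∀ k, S k) :=
    E.trans (DirectSum.linearEquivFunOnFintype B (Fin r) fun k ↦ S k)
  let χ : (∀ k, Submodule.span B ({g (c k)} : Set B)) →ₗ[B] (∀ k, S k) :=
    LinearMap.pi fun k ↦ f k ∘ₗ LinearMap.proj k
  have hχ : Function.Surjective χ := fun y ↦ by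
    choose x hx using fun k ↦ hf k (y k)
    exact ⟨x, funext hx⟩
  have : ∀ k, Module.Projective B (Submodule.span B ({g (c k)} : Set B)) :=
    fun k ↦ projective_span_singleton (hg.ortho.idem _)
  obtain ⟨φ, hφ⟩ := Module.projective_lifting_property
    (E'.toLinearMap ∘ₗ (Module.jacobson B M).mkQ) χ
    (E'.surjective.comp (Submodule.mkQ_surjective _))
  have hφ' : ∀ x, E' ((Module.jacobson B M).mkQ (φ x)) = χ x := fun x ↦ LinearMap.congr_fun hφ x
  refine ⟨r, c, φ, ?_, fun x hx k ↦ ?_⟩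
  · rw [← LinearMap.range_eq_top]
    apply range_eq_top_of_jacobson
    rw [eq_top_iff]
    intro y _
    obtain ⟨x, hx⟩ := hχ (E' y)
    exact ⟨φ x, ⟨x, rfl⟩, E'.injective (by rw [hφ', hx])⟩
  · have h2 : f k (x k) = 0 := by
      have := congr_fun (hφ' x) k
      rw [hx, map_zero, map_zero] at this
      exact this.symm
    rw [← (radIdem (g (c k))).ker_mkQ, LinearMap.mem_ker]
    exact (hc k).some.injective (by rw [map_zero]; exact h2)

end Cover

/-! ### Left-right symmetry of `KernelsProjective` -/

section Symmetry

lemma isNilpotent_mul_comm {B : Type u} [Ring B] {x y : B} (h : IsNilpotent (x * y)) :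
    IsNilpotent (y * x) := by
  obtain ⟨n, hn⟩ := h
  refine ⟨n + 1, ?_⟩
  have key : ∀ k : ℕ, (y * x) ^ (k + 1) = y * (x * y) ^ k * x := fun k ↦ by
    induction k with
    | zero => simp
    | succ k ih => rw [pow_succ, ih, pow_succ]; simp only [mul_assoc]
  rw [key, hn, mul_zero, zero_mul]

/-- Together with `isNilpotent_mul_comm`, this describes the radical in a way that is visibly the
same for the opposite ring. -/
lemma mem_jacobson_iff_isNilpotent {B : Type u} [Ring B] [IsArtinianRing B] {x : B} :
    x ∈ Ring.jacobson B ↔ ∀ b, IsNilpotent (b * x) := by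
  refine ⟨fun h b ↦ isNilpotent_of_mem_jacobson (Ideal.mul_mem_left _ _ h), fun h ↦ ?_⟩
  rw [Ring.jacobson_eq_sInf_isMaximal, Submodule.mem_sInf]
  intro I hI
  have hI : Ideal.IsMaximal I := hI
  by_contra hx
  obtain ⟨b, i, hi, hbi⟩ := hI.exists_inv hx
  have h1 : i = 1 - b * x := by rw [← hbi]; abel
  exact hI.ne_top (Ideal.eq_top_of_isUnit_mem I hi (h1 ▸ (h b).isUnit_one_sub))

lemma mem_jacobson_iff_of_opEquiv {B : Type u} [Ring B] [IsArtinianRing B] {B' : Type v} [Ring B']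
    [IsArtinianRing B'] (φ : B' ≃+* Bᵐᵒᵖ) (x : B') :
    MulOpposite.unop (φ x) ∈ Ring.jacobson B ↔ x ∈ Ring.jacobson B' := by
  have hnil : ∀ y : B', IsNilpotent (MulOpposite.unop (φ y)) ↔ IsNilpotent y := fun y ↦ by
    refine exists_congr fun k ↦ ?_
    rw [← MulOpposite.unop_pow, ← map_pow, MulOpposite.unop_eq_zero_iff, map_eq_zero_iff φ φ.injective]
  rw [mem_jacobson_iff_isNilpotent, mem_jacobson_iff_isNilpotent]
  constructor
  · intro h b
    have := h (MulOpposite.unop (φ b))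
    rw [← MulOpposite.unop_mul, ← map_mul, hnil] at this
    exact isNilpotent_mul_comm this
  · intro h b
    have := isNilpotent_mul_comm (h (φ.symm (MulOpposite.op b)))
    rw [← hnil, map_mul, MulOpposite.unop_mul, RingEquiv.apply_symm_apply,
      MulOpposite.unop_op] at this
    exact this

variable {B : Type u} [Ring B]

/-- The additive map `Xᵐ → Xⁿ` given by a matrix with entries in `B`. -/
def matAct {X : Type v} [AddCommGroup X] [Module B X] {n m : ℕ} (β : Fin n → Fin m → B)
    (x : Fin m → X) (i : Fin n) : X := ∑ k, β i k • x k

section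
variable {X : Type v} [AddCommGroup X] [Module B X] {Y : Type w} [AddCommGroup Y] [Module B Y]
  {n m l : ℕ}

lemma matAct_map (f : X →ₗ[B] Y) (β : Fin n → Fin m → B) (x : Fin m → X) :
    matAct β (fun k ↦ f (x k)) = fun i ↦ f (matAct β x i) := by
  ext i; simp [matAct]

lemma matAct_matAct (β : Fin n → Fin m → B) (γ : Fin m → Fin l → B) (x : Fin l → X) :
    matAct β (matAct γ x) = matAct (fun i k ↦ ∑ j, β i j * γ j k) x := by
  ext i
  simp only [matAct, Finset.smul_sum, Finset.sum_smul, smul_smul]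
  exact Finset.sum_comm

lemma matAct_sub (β : Fin n → Fin m → B) (x y : Fin m → X) :
    matAct β (fun k ↦ x k - y k) = fun i ↦ matAct β x i - matAct β y i := by
  ext i; simp [matAct, smul_sub]

end

/-- Matrices presenting the beginning of a projective resolution of `B ⧸ J` as a right module. -/
structure RadicalResolution (B : Type u) [Ring B] where
  n : ℕ
  m : ℕ
  a : Fin 1 → Fin n → B
  β : Fin n → Fin m → B
  p : Fin m → Fin m → B
  mem : ∀ i, a 0 i ∈ Ring.jacobson B
  gen : ∀ x ∈ Ring.jacobson B, ∃ y : Fin n → B, matAct a y 0 = x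
  comp : ∀ k, ∑ i, a 0 i * β i k = 0
  exact_left : ∀ y : Fin n → B, matAct a y = 0 → ∃ z, y = matAct β z
  ker : ∀ z : Fin m → B, matAct β z = 0 → matAct p z = 0
  comp_p : ∀ i k, ∑ j, β i j * p j k = β i k

lemma sum_smul_single {B : Type u} [Ring B] {m : ℕ} (z : Fin m → B) :
    ∑ k, z k • (Pi.single k 1 : Fin m → B) = z := by
  ext j; simp [Pi.single_apply]

/-- Over `B'` the kernel of a free cover `B'ⁿ → J` is projective by `hK`, hence a summand of some
`B'ᵐ`. Transported along the anti-isomorphism `θ`, the two maps become `a` and `β`, and `p` is the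
projector onto the summand. -/
lemma exists_radicalResolution [IsArtinianRing B] {B' : Type v} [Ring B'] [IsArtinianRing B']
    (φ : B' ≃+* Bᵐᵒᵖ) (hK : KernelsProjective B') : Nonempty (RadicalResolution B) := by
  classical
  let θ : B' ≃+ B := φ.toAddEquiv.trans MulOpposite.opAddEquiv.symm
  have θmul : ∀ x y, θ (x * y) = θ y * θ x := fun x y ↦ by
    simp [θ, MulOpposite.unop_mul]
  have θmem : ∀ x, θ x ∈ Ring.jacobson B ↔ x ∈ Ring.jacobson B' := mem_jacobson_iff_of_opEquiv φ
  obtain ⟨n, f, hf⟩ := Module.Finite.exists_fin' B' (Ring.jacobson B')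
  let f' : (Fin n → B') →ₗ[B'] B' := Submodule.subtype _ ∘ₗ f
  have hproj := hK n f'
  obtain ⟨m, π, hπ⟩ := Module.Finite.exists_fin' B' (LinearMap.ker f')
  obtain ⟨σ, hσ⟩ := Module.projective_lifting_property π LinearMap.id hπ
  have hf' : ∀ y : Fin n → B', f' y = ∑ i, y i * f' (Pi.single i 1) := fun y ↦ by
    conv_lhs => rw [← sum_smul_single y, map_sum]
    simp only [map_smul, smul_eq_mul]
  have hπ' : ∀ (z : Fin m → B') i, (π z : Fin n → B') i =
      ∑ k, z k * (π (Pi.single k 1) : Fin n → B') i := fun z i ↦ by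
    conv_lhs => rw [← sum_smul_single z, map_sum]
    simp [map_smul, smul_eq_mul]
  have hσ' : ∀ (z : Fin m → B') i, σ (π z) i = ∑ k, z k * σ (π (Pi.single k 1)) i := fun z i ↦ by
    conv_lhs => rw [← sum_smul_single z, map_sum, map_sum]
    simp [map_smul, smul_eq_mul]
  have hπσ : ∀ x, π (σ x) = x := fun x ↦ LinearMap.congr_fun hσ x
  have ha : ∀ y : Fin n → B', matAct (fun (_ : Fin 1) i ↦ θ (f' (Pi.single i 1)))
      (fun i ↦ θ (y i)) = fun _ ↦ θ (f' y) := fun y ↦ by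
    ext; simp [matAct, hf' y, θmul]
  have hβ : ∀ z : Fin m → B', matAct (fun i k ↦ θ ((π (Pi.single k 1) : Fin n → B') i))
      (fun k ↦ θ (z k)) = fun i ↦ θ ((π z : Fin n → B') i) := fun z ↦ by
    ext i; simp [matAct, hπ' z, θmul]
  have hp : ∀ z : Fin m → B', matAct (fun i k ↦ θ (σ (π (Pi.single k 1)) i))
      (fun k ↦ θ (z k)) = fun i ↦ θ (σ (π z) i) := fun z ↦ by
    ext i; simp [matAct, hσ' z, θmul]
  have hθ : ∀ {k : ℕ} (y : Fin k → B), y = fun i ↦ θ (θ.symm (y i)) := fun y ↦ by simp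
  refine ⟨⟨n, m, fun _ i ↦ θ (f' (Pi.single i 1)),
    fun i k ↦ θ ((π (Pi.single k 1) : Fin n → B') i), fun i k ↦ θ (σ (π (Pi.single k 1)) i),
    fun i ↦ (θmem _).2 (f _).2, fun x hx ↦ ?_, fun k ↦ ?_, fun y hy ↦ ?_, fun z hz ↦ ?_,
    fun i k ↦ ?_⟩⟩
  · obtain ⟨y, hy⟩ := hf ⟨θ.symm x, (θmem _).1 (by simpa using hx)⟩
    refine ⟨fun i ↦ θ (y i), ?_⟩
    rw [ha]
    have : f' y = θ.symm x := congr_arg Subtype.val hy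
    simp [this]
  · simp only [← θmul, ← map_sum]
    rw [← hf', LinearMap.mem_ker.1 (π (Pi.single k 1)).2, map_zero]
  · rw [hθ y, ha] at hy
    have h0 : f' (fun i ↦ θ.symm (y i)) = 0 := by simpa using congr_fun hy 0
    obtain ⟨z, hz⟩ := hπ ⟨_, LinearMap.mem_ker.2 h0⟩
    exact ⟨fun k ↦ θ (z k), by rw [hβ, hz]; simp⟩
  · rw [hθ z, hβ] at hz
    rw [hθ z, hp]
    have h0 : π (fun i ↦ θ.symm (z i)) = 0 := by
      ext i
      simpa using congr_fun hz i
    simp only [h0]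
    ext; simp
  · simp only [← θmul, ← map_sum]
    rw [← hπ', hπσ]

variable {X : Type v} [AddCommGroup X] [Module B X]

/-- Exactness of the resolution tensored with a finitely generated projective left module, checked
in the coordinates of a free module. -/
lemma RadicalResolution.exact_of_retract (R : RadicalResolution B) {r : ℕ}
    (s : X →ₗ[B] (Fin r → B)) (q : (Fin r → B) →ₗ[B] X) (h : q ∘ₗ s = LinearMap.id)
    {y : Fin R.n → X} (hy : matAct R.a y = 0) : ∃ z, y = matAct R.β z := by
  have h1 : ∀ j, ∃ z : Fin R.m → B, (fun i ↦ s (y i) j) = matAct R.β z := fun j ↦ by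
    apply R.exact_left
    refine (matAct_map (LinearMap.proj j ∘ₗ s) R.a y).trans ?_
    rw [hy]
    ext; simp
  choose z hz using h1
  refine ⟨fun k ↦ q (fun j ↦ z j k), ?_⟩
  rw [matAct_map q]
  ext i
  have : matAct R.β (fun k j ↦ z j k) i = s (y i) := by
    ext j
    rw [congr_fun (hz j) i]
    simp [matAct]
  rw [this]
  exact (LinearMap.congr_fun h (y i)).symm

lemma RadicalResolution.ker_of_retract (R : RadicalResolution B) {r : ℕ}
    (s : X →ₗ[B] (Fin r → B)) (q : (Fin r → B) →ₗ[B] X) (h : q ∘ₗ s = LinearMap.id)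
    {z : Fin R.m → X} (hz : matAct R.β z = 0) : matAct R.p z = 0 := by
  have hs : Function.Injective s := Function.LeftInverse.injective (g := q) fun x ↦
    LinearMap.congr_fun h x
  ext i
  apply hs
  ext j
  have h1 := R.ker (fun k ↦ s (z k) j) (by
    refine (matAct_map (LinearMap.proj j ∘ₗ s) R.β z).trans ?_
    rw [hz]
    ext; simp)
  have h2 := congr_fun ((matAct_map (LinearMap.proj j ∘ₗ s) R.p z).symm.trans h1) i
  simpa using h2

lemma RadicalResolution.matAct_p (R : RadicalResolution B) (z : Fin R.m → X) :
    matAct R.β (matAct R.p z) = matAct R.β z := by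
  rw [matAct_matAct]
  simp only [R.comp_p]

lemma RadicalResolution.matAct_comp (R : RadicalResolution B) (z : Fin R.m → X) :
    matAct R.a (matAct R.β z) = 0 := by
  rw [matAct_matAct]
  ext i
  rw [Subsingleton.elim i 0]
  simp [matAct, R.comp]

/-- The matrices resolve the right module `B ⧸ J` in length two, so `Tor₁(B ⧸ J, ker f)`, which is
`Tor₃(B ⧸ J, coker f)`, vanishes. A finitely generated module over an artinian ring with vanishing
`Tor₁(B ⧸ J, -)` is projective. -/
lemma RadicalResolution.kernelsProjective [IsArtinianRing B] (R : RadicalResolution B) :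
    KernelsProjective B := by
  intro r f
  obtain ⟨n, g, hg⟩ := exists_isBasicFamily B
  obtain ⟨d, c, q, hq, hqJ⟩ := hg.exists_cover (LinearMap.ker f)
  let F := ∀ k, Submodule.span B ({g (c k)} : Set B)
  have hcoe : ∀ {k l : ℕ} (γ : Fin k → Fin l → B) (x : Fin l → LinearMap.ker f) i,
      ((matAct γ x i : LinearMap.ker f) : Fin r → B) = matAct γ (fun k ↦ (x k : Fin r → B)) i :=
    fun γ x i ↦ (congr_fun (matAct_map (Submodule.subtype _) γ x) i).symm
  have : ∀ k, Module.Projective B (Submodule.span B ({g (c k)} : Set B)) :=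
    fun k ↦ projective_span_singleton (hg.ortho.idem _)
  -- Vanishing of `Tor₁`. In the free module `x = β y`; then `β f(y) = 0`, so `p f(y) = 0`, and `p
  -- y` is a preimage of `x` with entries in `ker f`.
  have chase : ∀ x : Fin R.n → LinearMap.ker f, matAct R.a x = 0 → ∃ z, x = matAct R.β z := by
    intro x hx
    obtain ⟨y, hy⟩ := R.exact_of_retract (LinearMap.id (M := Fin r → B)) LinearMap.id rfl
      (y := fun i ↦ (x i : Fin r → B)) (by ext1 i; rw [← hcoe, hx]; rfl)
    have h1 : matAct R.β (fun k ↦ f (y k)) = 0 := by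
      rw [matAct_map, ← hy]
      ext i; exact (x i).2
    have h2 := R.ker_of_retract (LinearMap.toSpanSingleton B (Fin 1 → B) 1) (LinearMap.proj 0)
      (by ext; simp) h1
    rw [matAct_map] at h2
    refine ⟨fun k ↦ ⟨matAct R.p y k, congr_fun h2 k⟩, ?_⟩
    ext1 i
    apply Subtype.ext
    rw [hcoe, R.matAct_p, ← hy]
  -- Nakayama for `L = ker q`. Any `l ∈ L` is radical, so `l = a t`; by `chase` the image `q(t)` is
  -- `β s`, and a lift `s'` of `s` gives `l = a (t - β s')` with `t - β s'` in `L`. Hence `L ⊆ J L`.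
  have hbot : LinearMap.ker q = ⊥ := by
    refine Submodule.FG.eq_bot_of_le_jacobson_smul (IsNoetherian.noetherian _) fun l hl ↦ ?_
    have h1 : ∀ k, ∃ y : Fin R.n → B, matAct R.a y 0 = l k := fun k ↦ R.gen _ (hqJ l hl k)
    choose y hy using h1
    let t : Fin R.n → F := fun i k ↦ y k i • genIdem (g (c k))
    have ht : matAct R.a t 0 = l := by
      ext k
      have h2 := (mem_span_singleton_iff_mul (hg.ortho.idem (c k))).1 (l k).2
      rw [← h2, ← hy]
      have h3 := congr_fun (matAct_map
        (Submodule.subtype _ ∘ₗ LinearMap.proj (R := B) k : F →ₗ[B] B) R.a t) 0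
      refine h3.symm.trans ?_
      simp only [matAct, Finset.sum_mul, smul_eq_mul, mul_assoc]
      rfl
    obtain ⟨s, hs⟩ := chase (fun i ↦ q (t i)) (by
      rw [matAct_map]
      ext1 i
      rw [Subsingleton.elim i 0, ht]
      exact hl)
    choose s' hs' using fun k ↦ hq (s k)
    have hker : ∀ i, t i - matAct R.β s' i ∈ LinearMap.ker q := fun i ↦ by
      rw [LinearMap.mem_ker, map_sub, ← congr_fun (matAct_map q R.β s') i]
      simp only [hs', ← hs, sub_self]
    have hl' : l = ∑ i, R.a 0 i • (t i - matAct R.β s' i) := by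
      have h3 := congr_fun (matAct_sub R.a t (matAct R.β s')) 0
      rw [R.matAct_comp, ht] at h3
      simpa [matAct] using h3.symm
    rw [hl']
    exact Submodule.sum_mem _ fun i _ ↦ Submodule.smul_mem_smul (R.mem i) (hker i)
  exact .of_equiv (LinearEquiv.ofBijective q ⟨LinearMap.ker_eq_bot.1 hbot, hq⟩)

lemma KernelsProjective.of_opEquiv [IsArtinianRing B] {B' : Type v} [Ring B'] [IsArtinianRing B']
    (hK : KernelsProjective B') (φ : B' ≃+* Bᵐᵒᵖ) : KernelsProjective B :=
  (exists_radicalResolution φ hK).some.kernelsProjective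

end Symmetry
end StronglyQH

namespace StronglyQH

-- Dimension shifting along `0 → im f → B → coker f → 0` and `0 → ker f → Bⁿ → im f → 0`.
open CategoryTheory in
lemma kernelsProjective_of_globalDimension_le_two {A : Type u} [Ring A]
    (hA : globalDimension A ≤ 2) : KernelsProjective Aᵐᵒᵖ := by
  intro n f
  let q := (LinearMap.range f).mkQ
  have hq : Function.Surjective q := Submodule.mkQ_surjective _
  let f' : (Fin n → Aᵐᵒᵖ) →ₗ[Aᵐᵒᵖ] LinearMap.ker q :=
    f.codRestrict _ fun x ↦ by simp [q]
  have hf' : Function.Surjective f' := by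
    rintro ⟨y, hy⟩
    rw [Submodule.ker_mkQ] at hy
    obtain ⟨x, rfl⟩ := hy
    exact ⟨x, rfl⟩
  have h1 : projectiveDimension (ModuleCat.of Aᵐᵒᵖ (Aᵐᵒᵖ ⧸ LinearMap.range f)) ≤ (2 : ℕ) :=
    le_trans (le_iSup₂_of_le (f := fun (M : ModuleCat.{u} Aᵐᵒᵖ) (_ : Module.Finite Aᵐᵒᵖ M) ↦
      projectiveDimension M) _ inferInstance le_rfl) hA
  rw [projectiveDimension_le_iff] at h1
  have hproj : ∀ k : ℕ, Projective (ModuleCat.of Aᵐᵒᵖ (Fin k → Aᵐᵒᵖ)) := fun k ↦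
    (IsProjective.iff_projective _).1 inferInstance
  have hproj' : Projective (ModuleCat.of Aᵐᵒᵖ Aᵐᵒᵖ) :=
    (IsProjective.iff_projective _).1 inferInstance
  have h2 := ((LinearMap.shortExact_shortComplexKer hq).hasProjectiveDimensionLT_X₃_iff 1
    hproj').1 h1
  have h3 := ((LinearMap.shortExact_shortComplexKer hf').hasProjectiveDimensionLT_X₃_iff 0
    (hproj n)).1 h2
  have h4 := projective_iff_hasProjectiveDimensionLT_one.2 h3
  have h5 : Module.Projective Aᵐᵒᵖ (LinearMap.ker f') := (IsProjective.iff_projective _).2 h4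
  rwa [LinearMap.ker_codRestrict] at h5

/-! ### Filtrations as iterated extensions -/

section Filtrations

variable {B : Type u} [Ring B]

/-- Modules that are iterated extensions of the modules `X j`, `j ∈ T`. -/
inductive Filtered {J : Type w} (X : J → ModuleCat.{u} B) (T : Set J) : ModuleCat.{u} B → Prop
  | zero (M : ModuleCat.{u} B) (h : Subsingleton M) : Filtered X T M
  | step (M : ModuleCat.{u} B) (N : Submodule B M) (j : J) (hj : j ∈ T)
      (e : Nonempty ((M ⧸ N) ≃ₗ[B] X j)) (h : Filtered X T (ModuleCat.of B N)) : Filtered X T M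

variable {J : Type w} {X : J → ModuleCat.{u} B} {T : Set J}

lemma Filtered.mono {T' : Set J} (hT : T ⊆ T') {M : ModuleCat.{u} B} (h : Filtered X T M) :
    Filtered X T' M := by
  induction h with
  | zero M h => exact .zero M h
  | step M N j hj e h ih => exact .step M N j (hT hj) e ih

lemma Filtered.of_equiv {M M' : ModuleCat.{u} B} (h : Filtered X T M) (f : M ≃ₗ[B] M') :
    Filtered X T M' := by
  induction h generalizing M' with
  | zero M h => exact .zero M' (f.symm.toEquiv.subsingleton)
  | step M N j hj e h ih =>
    refine .step M' (N.map f.toLinearMap) j hj ?_ (ih (M' := ModuleCat.of B _) (f.submoduleMap N))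
    exact ⟨(Submodule.Quotient.equiv N _ f rfl).symm.trans e.some⟩

/-- Pull the filtration of `Q` back along `q`; below it remains a copy of `K`. -/
lemma Filtered.extension {M Q : ModuleCat.{u} B} (hQ : Filtered X T Q) {K : ModuleCat.{u} B}
    (hK : Filtered X T K) (f : K →ₗ[B] M) (hf : Function.Injective f) (q : M →ₗ[B] Q)
    (hq : Function.Surjective q) (h : LinearMap.range f = LinearMap.ker q) : Filtered X T M := by
  induction hQ generalizing M with
  | zero Q hQ =>
    have h0 : LinearMap.ker q = ⊤ := by
      rw [eq_top_iff]; intro x _; exact Subsingleton.elim _ _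
    exact hK.of_equiv (LinearEquiv.ofBijective f ⟨hf, LinearMap.range_eq_top.1 (h.trans h0)⟩)
  | step Q N j hj e hN ih =>
    have hfL : ∀ x, f x ∈ N.comap q := fun x ↦ by
      have : f x ∈ LinearMap.ker q := h ▸ LinearMap.mem_range_self f x
      rw [Submodule.mem_comap, LinearMap.mem_ker.1 this]
      exact N.zero_mem
    have E : (M ⧸ N.comap q) ≃ₗ[B] (Q ⧸ N) :=
      (Submodule.quotEquivOfEq _ _ (by rw [LinearMap.ker_comp, Submodule.ker_mkQ])).trans
        ((N.mkQ ∘ₗ q).quotKerEquivOfSurjective ((Submodule.mkQ_surjective _).comp hq))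
    refine .step M (N.comap q) j hj ⟨E.trans e.some⟩
      (ih (M := ModuleCat.of B (N.comap q)) (f.codRestrict _ hfL) ?_ (q.restrict fun x hx ↦ hx)
        ?_ ?_)
    · intro x y hxy
      exact hf (congr_arg Subtype.val hxy)
    · rintro ⟨y, hy⟩
      obtain ⟨x, rfl⟩ := hq y
      exact ⟨⟨x, hy⟩, rfl⟩
    · ext x
      have h1 : (x : M) ∈ LinearMap.range f ↔ (x : M) ∈ LinearMap.ker q := by rw [h]
      simp only [LinearMap.mem_range, LinearMap.mem_ker] at h1
      simp only [LinearMap.mem_range, LinearMap.mem_ker, Subtype.ext_iff]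
      exact h1

lemma Filtered.pi {r : ℕ} (Y : Fin r → Type u) [∀ k, AddCommGroup (Y k)] [∀ k, Module B (Y k)]
    (h : ∀ k, Filtered X T (ModuleCat.of B (Y k))) :
    Filtered X T (ModuleCat.of B (∀ k, Y k)) := by
  induction r with
  | zero => exact .zero _ (inferInstanceAs (Subsingleton (∀ k, Y k)))
  | succ r ih =>
    let f : (∀ k : Fin r, Y k.succ) →ₗ[B] (∀ k, Y k) :=
      { toFun := fun x ↦ Fin.cons 0 x
        map_add' := fun x y ↦ by
          ext k; refine Fin.cases ?_ (fun k ↦ ?_) k <;> simp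
        map_smul' := fun b x ↦ by
          ext k; refine Fin.cases ?_ (fun k ↦ ?_) k <;> simp }
    refine (h 0).extension (ih (fun k ↦ Y k.succ) fun k ↦ h k.succ) f
      (fun x y hxy ↦ ?_) (LinearMap.proj 0) (fun y ↦ ?_) ?_
    · ext k
      exact congr_fun hxy k.succ
    · exact ⟨Fin.cons y 0, rfl⟩
    · ext x
      constructor
      · rintro ⟨y, rfl⟩; rfl
      · intro hx
        refine ⟨fun k ↦ x k.succ, ?_⟩
        ext k
        refine Fin.cases ?_ (fun k ↦ ?_) k
        · exact (show x 0 = 0 from hx).symm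
        · rfl

/-- Subquotients are preserved by injective linear maps. -/
noncomputable def subquotientEquiv {M : Type v} [AddCommGroup M] [Module B M] {N : Type w}
    [AddCommGroup N] [Module B N] (f : N →ₗ[B] M) (hf : Function.Injective f)
    (L L' : Submodule B N) : (L ⧸ L'.submoduleOf L) ≃ₗ[B]
      (L.map f ⧸ (L'.map f).submoduleOf (L.map f)) :=
  Submodule.Quotient.equiv _ _ (Submodule.equivMapOfInjective f hf L) (by
    ext ⟨x, hx⟩
    constructor
    · rintro ⟨y, hy, hyx⟩
      exact ⟨y, hy, congr_arg Subtype.val hyx⟩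
    · rintro ⟨y, hy, hyx⟩
      obtain ⟨z, hz, hzx⟩ := hx
      obtain rfl : y = z := hf (hyx.trans hzx.symm)
      exact ⟨⟨y, hz⟩, hy, Subtype.ext hyx⟩)

lemma Filtered.hasFiltration {M : ModuleCat.{u} B} (h : Filtered X T M) : HasFiltration X T M := by
  induction h with
  | zero M h =>
    exact ⟨0, fun _ ↦ ⊤, rfl, Subsingleton.elim _ _, fun k ↦ k.elim0⟩
  | step M N j hj e h ih =>
    obtain ⟨l, F, hF0, hFl, hF⟩ := ih
    have hinj : Function.Injective N.subtype := N.subtype_injective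
    refine ⟨l + 1, Fin.cons ⊤ fun k ↦ (F k).map N.subtype, rfl, ?_, fun k ↦ ?_⟩
    · rw [← Fin.succ_last, Fin.cons_succ, hFl]
      exact Submodule.map_bot _
    · refine Fin.cases ?_ (fun k ↦ ?_) k
      · have h0 : (F 0).map N.subtype = N := by
          rw [hF0]; exact (Submodule.map_top _).trans N.range_subtype
        have E : ((⊤ : Submodule B M) ⧸ ((F 0).map N.subtype).submoduleOf ⊤) ≃ₗ[B] (M ⧸ N) := by
          refine Submodule.Quotient.equiv _ _ Submodule.topEquiv ?_
          rw [h0]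
          ext x
          constructor
          · rintro ⟨y, hy, rfl⟩; exact hy
          · intro hx; exact ⟨⟨x, trivial⟩, hx, rfl⟩
        exact ⟨le_top, j, hj, ⟨E.trans e.some⟩⟩
      · obtain ⟨hle, i, hi, ⟨E⟩⟩ := hF k
        rw [Fin.castSucc_succ]
        refine ⟨Submodule.map_mono hle, i, hi,
          ⟨(subquotientEquiv N.subtype hinj (F k.castSucc) (F k.succ)).symm.trans E⟩⟩

end Filtrations
end StronglyQH

namespace StronglyQH

/-! ### Detecting composition factors by idempotents -/

section CompositionFactors

variable {B : Type u} [Ring B]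

lemma IsCompositionFactor.smul_eq_zero {S : Type v} [AddCommGroup S] [Module B S]
    {M : Type w} [AddCommGroup M] [Module B M] (h : IsCompositionFactor (B := B) S M) {e : B}
    (he : ∀ x : M, e • x = 0) (t : S) : e • t = 0 := by
  obtain ⟨L, N, -, ⟨f⟩⟩ := h
  obtain ⟨y, rfl⟩ := f.surjective t
  obtain ⟨x, rfl⟩ := Submodule.Quotient.mk_surjective _ y
  have : e • x = 0 := Subtype.ext (he x)
  rw [← map_smul, ← Submodule.Quotient.mk_smul, this, Submodule.Quotient.mk_zero, map_zero]

/-- The subquotient is `B g x` modulo the image of the radical of `B g`; the kernel of `B g → B g x`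
is proper, hence contained in that radical. -/
lemma IsLocalIdem.isCompositionFactor {g : B} (hg : IsLocalIdem g) {M : Type w} [AddCommGroup M]
    [Module B M] {x : M} (hx : g • x ≠ 0) :
    IsCompositionFactor (B := B) (Submodule.span B ({g} : Set B) ⧸ radIdem g) M := by
  let f := evalIdem g x
  have hf : LinearMap.ker f ≤ radIdem g := hg.le_radIdem fun h ↦ hx (by
    have : genIdem g ∈ LinearMap.ker f := h ▸ trivial
    exact this)
  refine ⟨LinearMap.range f, (radIdem g).map f, LinearMap.map_le_range, ⟨?_⟩⟩
  let q : Submodule.span B ({g} : Set B) →ₗ[B]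
      (LinearMap.range f ⧸ ((radIdem g).map f).submoduleOf (LinearMap.range f)) :=
    Submodule.mkQ _ ∘ₗ f.rangeRestrict
  have hq : Function.Surjective q :=
    (Submodule.mkQ_surjective _).comp f.surjective_rangeRestrict
  have hker : LinearMap.ker q = radIdem g := by
    rw [LinearMap.ker_comp, Submodule.ker_mkQ]
    ext y
    constructor
    · rintro ⟨z, hz, hzy⟩
      have h1 : y - z ∈ LinearMap.ker f := by
        rw [LinearMap.mem_ker, map_sub, hzy]; exact sub_self _
      simpa using (radIdem g).add_mem (hf h1) hz
    · intro hy
      exact ⟨y, hy, rfl⟩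
  exact (q.quotKerEquivOfSurjective hq).symm.trans (Submodule.quotEquivOfEq _ _ hker)

end CompositionFactors

/-! ### Standard modules and strong quasi-heredity -/

section Standard

variable {B : Type u} [Ring B] {n : ℕ} {g : Fin n → B}

lemma IsBasicFamily.smul_eq_zero (hg : IsBasicFamily g) {i j : Fin n} (hij : i ≠ j)
    (t : Submodule.span B ({g j} : Set B) ⧸ radIdem (g j)) : g i • t = 0 := by
  obtain ⟨x, rfl⟩ := Submodule.Quotient.mk_surjective _ t
  rw [← Submodule.Quotient.mk_smul, Submodule.Quotient.mk_eq_zero, mem_radIdem]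
  have h1 := hg.mul_mem j i hij.symm x
  rwa [mul_assoc, (mem_span_singleton_iff_mul (hg.ortho.idem j)).1 x.2] at h1

lemma IsBasicFamily.tailSum_smul_eq_zero (hg : IsBasicFamily g) {k : ℕ} {j : Fin n} (hjk : j.val < k)
    (t : Submodule.span B ({g j} : Set B) ⧸ radIdem (g j)) : tailSum g k • t = 0 := by
  rw [tailSum, Finset.sum_smul]
  refine Finset.sum_eq_zero fun i hi ↦ hg.smul_eq_zero ?_ t
  rintro rfl
  have := (Finset.mem_filter.1 hi).2
  omega

lemma IsBasicFamily.isIdempotentElem_tailSum (hg : IsBasicFamily g) (k : ℕ) :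
    IsIdempotentElem (tailSum g k) := hg.ortho.isIdempotentElem_sum

lemma IsBasicFamily.mul_tailSum (hg : IsBasicFamily g) {k : ℕ} {j : Fin n} (hjk : k ≤ j.val) :
    g j * tailSum g k = g j :=
  hg.ortho.mul_sum_of_mem (by simpa using hjk)

lemma IsBasicFamily.tailSum_mul (hg : IsBasicFamily g) {k : ℕ} {j : Fin n} (hjk : k ≤ j.val) :
    tailSum g k * g j = g j := by
  rw [tailSum, Finset.sum_mul, Finset.sum_eq_single j]
  · exact (hg.ortho.idem j).eq
  · intro i _ hij; exact hg.ortho.ortho hij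
  · intro h; exact absurd hjk (by simpa using h)

lemma IsBasicFamily.tailSum_smul_ne_zero (hg : IsBasicFamily g) {k : ℕ} {j : Fin n}
    (hjk : k ≤ j.val) :
    ∃ t : Submodule.span B ({g j} : Set B) ⧸ radIdem (g j), tailSum g k • t ≠ 0 := by
  refine ⟨Submodule.Quotient.mk (genIdem (g j)), fun h ↦ idem_smul_mk_ne_zero (hg.isLocal j) ?_⟩
  have h1 : g j * tailSum g k = g j := hg.mul_tailSum hjk
  generalize (Submodule.Quotient.mk (genIdem (g j)) : _ ⧸ radIdem (g j)) = t at h ⊢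
  calc g j • t = (g j * tailSum g k) • t := by rw [h1]
    _ = 0 := by rw [mul_smul, h, smul_zero]

/-- The simple modules `B (g i) / J (g i)` and their projective covers `B (g i)`. -/
def IsBasicFamily.simples (hg : IsBasicFamily g) : SimplesWithCovers B (Fin n) where
  S i := ModuleCat.of B (Submodule.span B ({g i} : Set B) ⧸ radIdem (g i))
  simple i := (hg.isLocal i).isSimpleModule
  eq_of_iso i j := fun ⟨f⟩ ↦ by
    by_contra hij
    exact exists_smul_ne_zero_of_equiv f (idem_smul_mk_ne_zero (hg.isLocal i))
      (hg.smul_eq_zero hij _)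
  exists_iso T _ := (hg.exists_equiv T).imp fun _ ⟨f⟩ ↦ ⟨f.symm⟩
  P i := ModuleCat.of B (Submodule.span B ({g i} : Set B))
  π i := (radIdem (g i)).mkQ
  isProjectiveCover i :=
    { projective := projective_span_singleton (hg.ortho.idem i)
      surjective := Submodule.mkQ_surjective _
      superfluous := fun N hN ↦ by
        rw [Submodule.ker_mkQ] at hN
        by_contra hne
        rw [sup_eq_right.2 ((hg.isLocal i).le_radIdem hne)] at hN
        exact (hg.isLocal i).radIdem_ne_top hN }

/-- A simple `S(j)` is a composition factor exactly when `g j` acts nontrivially. Excluding all `j >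
i` therefore means that `tailSum g (i + 1)` annihilates the quotient. -/
lemma IsBasicFamily.sInf_eq_trace (hg : IsBasicFamily g) (i : Fin n) :
    sInf {U : Submodule B (Submodule.span B ({g i} : Set B)) | ∀ j : Fin n,
      IsCompositionFactor (B := B) (Submodule.span B ({g j} : Set B) ⧸ radIdem (g j))
        (Submodule.span B ({g i} : Set B) ⧸ U) → j ≤ i} = trace (tailSum g (i + 1)) ⊤ := by
  apply le_antisymm
  · refine sInf_le fun j hj ↦ ?_
    by_contra hij
    have hij' : i.val + 1 ≤ j.val := not_le.1 hij
    obtain ⟨t, ht⟩ := hg.tailSum_smul_ne_zero hij'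
    refine ht (hj.smul_eq_zero (fun x ↦ ?_) t)
    obtain ⟨y, rfl⟩ := Submodule.Quotient.mk_surjective _ x
    rw [← Submodule.Quotient.mk_smul, Submodule.Quotient.mk_eq_zero]
    exact smul_mem_trace _ trivial
  · refine le_sInf fun U hU ↦ trace_le_iff.2 fun x _ ↦ ?_
    rw [← Submodule.Quotient.mk_eq_zero, Submodule.Quotient.mk_smul, tailSum, Finset.sum_smul]
    refine Finset.sum_eq_zero fun j hj ↦ ?_
    by_contra hne
    have h1 : j.val ≤ i.val := hU j ((hg.isLocal j).isCompositionFactor hne)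
    have := (Finset.mem_filter.1 hj).2
    omega

lemma IsBasicFamily.K_eq (hg : IsBasicFamily g) (i : Fin n) :
    hg.simples.K i =
      trace (tailSum g (i + 1)) (⊤ : Submodule B (Submodule.span B ({g i} : Set B))) :=
  hg.sInf_eq_trace i

lemma IsBasicFamily.Δ_eq (hg : IsBasicFamily g) (i : Fin n) :
    hg.simples.Δ i = ModuleCat.of B (Submodule.span B ({g i} : Set B) ⧸
      trace (tailSum g (i + 1)) (⊤ : Submodule B (Submodule.span B ({g i} : Set B)))) :=
  congr_arg (fun U : Submodule B (Submodule.span B ({g i} : Set B)) ↦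
    ModuleCat.of B (Submodule.span B ({g i} : Set B) ⧸ U)) (hg.sInf_eq_trace i)

lemma IsBasicFamily.trace_le_radIdem (hg : IsBasicFamily g) (i : Fin n) :
    trace (tailSum g (i + 1)) (⊤ : Submodule B (Submodule.span B ({g i} : Set B))) ≤
      radIdem (g i) := by
  refine trace_le_iff.2 fun x _ ↦ ?_
  rw [← Submodule.Quotient.mk_eq_zero, Submodule.Quotient.mk_smul]
  exact hg.tailSum_smul_eq_zero (Nat.lt_succ_self _) _

/-- For `y` in the radical of `B g_i`, `g_i y = g_i (e_i y g_i)` lies in the ideal of `e_{i+1}`,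
where `e_k = tailSum g k`. Thus `g i` kills the radical of `Δ(i)` but not `S(i)`. -/
lemma IsRejectiveFamily.multiplicity_one (hg : IsRejectiveFamily g) (i : Fin n) :
    ¬ IsCompositionFactor (B := B) (hg.simples.S i) (Module.jacobson B (hg.simples.Δ i)) := by
  rw [hg.Δ_eq]
  intro h
  refine idem_smul_mk_ne_zero (hg.isLocal i) (h.smul_eq_zero (fun x ↦ Subtype.ext ?_) _)
  obtain ⟨x, hx⟩ := x
  obtain ⟨y, rfl⟩ := Submodule.Quotient.mk_surjective _ x
  have hrad : y ∈ radIdem (g i) := by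
    have := (hg.isLocal i).isSimpleModule
    have h1 := Module.map_jacobson_le (Submodule.factor (hg.trace_le_radIdem i))
      (Submodule.mem_map_of_mem hx)
    rw [IsSimpleModule.jacobson_eq_bot, Submodule.mem_bot] at h1
    exact (Submodule.Quotient.mk_eq_zero _).1 h1
  change g i • Submodule.Quotient.mk y = 0
  rw [← Submodule.Quotient.mk_smul, Submodule.Quotient.mk_eq_zero]
  have hyg : (y : B) * g i = y := (mem_span_singleton_iff_mul (hg.ortho.idem i)).1 y.2
  have h2 := Submodule.smul_mem _ (g i) (hg.mul_mem_trace i (y : B) hrad)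
  rw [smul_eq_mul, mul_assoc, ← mul_assoc, hg.mul_tailSum le_rfl, hyg] at h2
  have h3 := apply_mem_trace _ (LinearMap.toSpanSingleton B _ (genIdem (g i))) h2
  rw [LinearMap.toSpanSingleton_apply, mul_smul, ← eq_smul_genIdem (hg.ortho.idem i)] at h3
  exact h3

variable [IsArtinianRing B]

/-- The cover `φ` splits, so its kernel is the image of the projector `κ`; being also contained in
the radical, it satisfies `ker φ ⊆ J ker φ` and vanishes by Nakayama. -/
lemma IsBasicFamily.exists_equiv_pi (hg : IsBasicFamily g) (Q : Type v) [AddCommGroup Q]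
    [Module B Q] [Module.Finite B Q] [Module.Projective B Q] :
    ∃ (r : ℕ) (c : Fin r → Fin n),
      Nonempty ((∀ k, Submodule.span B ({g (c k)} : Set B)) ≃ₗ[B] Q) := by
  classical
  obtain ⟨r, c, φ, hφ, hφJ⟩ := hg.exists_cover Q
  refine ⟨r, c, ⟨LinearEquiv.ofBijective φ ⟨LinearMap.ker_eq_bot.1 ?_, hφ⟩⟩⟩
  obtain ⟨s, hs⟩ := Module.projective_lifting_property φ LinearMap.id hφ
  have hs' : ∀ y, φ (s y) = y := fun y ↦ LinearMap.congr_fun hs y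
  refine Submodule.FG.eq_bot_of_le_jacobson_smul (IsNoetherian.noetherian _) fun x hx ↦ ?_
  let κ : (∀ k, Submodule.span B ({g (c k)} : Set B)) →ₗ[B]
      (∀ k, Submodule.span B ({g (c k)} : Set B)) := LinearMap.id - s ∘ₗ φ
  have hκ : ∀ y, κ y ∈ LinearMap.ker φ := fun y ↦ by
    simp [κ, hs']
  have hκx : κ x = x := by simp [κ, LinearMap.mem_ker.1 hx]
  have hx' : x = ∑ k, ((x k : B)) • Pi.single k (genIdem (g (c k))) := by
    conv_lhs => rw [← Finset.univ_sum_single x]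
    refine Finset.sum_congr rfl fun k _ ↦ ?_
    rw [← Pi.single_smul, ← eq_smul_genIdem (hg.ortho.idem _)]
  rw [← hκx, hx', map_sum]
  refine Submodule.sum_mem _ fun k _ ↦ ?_
  rw [map_smul]
  exact Submodule.smul_mem_smul (hφJ x hx k) (hκ _)

/-- `Q` is a sum of modules `B g_c` with `c ≥ k`. Each has quotient `Δ(c)` and kernel the trace of
`tailSum g (c + 1)`, which is again projective and generated by its trace for a larger index; `d`
bounds the number of remaining steps. -/
lemma IsRejectiveFamily.filtered (hg : IsRejectiveFamily g) (d k : ℕ) (hd : n ≤ k + d)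
    (Q : ModuleCat.{u} B) (hfin : Module.Finite B Q) (hproj : Module.Projective B Q)
    (htr : trace (tailSum g k) (⊤ : Submodule B Q) = ⊤) :
    Filtered hg.toIsBasicFamily.simples.Δ {j | k ≤ j.val} Q := by
  induction d generalizing k Q with
  | zero =>
    refine .zero _ ⟨fun x y ↦ ?_⟩
    rw [tailSum_of_le g (k := k) hd] at htr
    have h0 : ∀ z : Q, z = 0 := fun z ↦ by
      have hz : z ∈ (⊤ : Submodule B Q) := trivial
      rw [← htr] at hz
      exact (trace_le_iff (L := ⊥)).2 (fun x _ ↦ by simp) hz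
    rw [h0 x, h0 y]
  | succ d ih =>
    obtain ⟨r, c, ⟨E⟩⟩ := hg.exists_equiv_pi Q
    refine Filtered.of_equiv (M := ModuleCat.of B (∀ k, Submodule.span B ({g (c k)} : Set B))) ?_ E
    refine Filtered.pi _ fun l ↦ ?_
    have hfin' : Module.Finite B (Submodule.span B ({g (c l)} : Set B)) := inferInstance
    have hproj' : Module.Projective B (Submodule.span B ({g (c l)} : Set B)) :=
      projective_span_singleton (hg.ortho.idem _)
    have hkl : k ≤ (c l).val := by
      by_contra hlt
      have h1 := trace_eq_top_of_surjective _ (Submodule.mkQ (radIdem (g (c l))) ∘ₗ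
        LinearMap.proj l ∘ₗ E.symm.toLinearMap) (by
          refine (Submodule.mkQ_surjective _).comp ?_
          exact (Function.surjective_eval l).comp E.symm.surjective) htr
      have h2 : trace (tailSum g k)
          (⊤ : Submodule B (Submodule.span B ({g (c l)} : Set B) ⧸ radIdem (g (c l)))) ≤ ⊥ :=
        trace_le_iff.2 fun t _ ↦ by
          rw [hg.tailSum_smul_eq_zero (not_le.1 hlt) t]; exact zero_mem _
      rw [h1] at h2
      exact idem_smul_mk_ne_zero (hg.isLocal (c l)) ((Submodule.mem_bot B).1 (h2 trivial))
    refine .step (ModuleCat.of B (Submodule.span B ({g (c l)} : Set B)))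
      (trace (tailSum g (c l + 1)) ⊤) (c l) hkl ?_ ?_
    · rw [hg.Δ_eq]
      exact ⟨LinearEquiv.refl _ _⟩
    refine (ih ((c l).val + 1) (by omega) (ModuleCat.of B _) inferInstance
      (projective_trace (hg.projective _)) ?_).mono fun j hj ↦ ?_
    · exact (trace_top_eq_top_iff _ _).2 (trace_self (hg.isIdempotentElem_tailSum _) _)
    · have hj' : (c l).val + 1 ≤ j.val := hj
      change k ≤ j.val
      omega

end Standard

lemma KernelsProjective.isRightStronglyQuasiHereditary {A : Type u} [Ring A]
    [IsArtinianRing Aᵐᵒᵖ] (hK : KernelsProjective Aᵐᵒᵖ) : IsRightStronglyQuasiHereditary A := by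
  obtain ⟨n, g, hg⟩ := hK.exists_isRejectiveFamily
  have hproj : ∀ i : Fin n, Module.Projective Aᵐᵒᵖ (trace (tailSum g (i + 1))
      (⊤ : Submodule Aᵐᵒᵖ (Submodule.span Aᵐᵒᵖ ({g i} : Set Aᵐᵒᵖ)))) := fun i ↦ by
    have : Module.Projective Aᵐᵒᵖ (Submodule.span Aᵐᵒᵖ ({g i} : Set Aᵐᵒᵖ)) :=
      projective_span_singleton (hg.ortho.idem i)
    exact projective_trace (hg.projective _)
  refine ⟨Fin n, inferInstance, inferInstance, hg.simples, hg.multiplicity_one, fun i ↦ ?_,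
    fun i ↦ ?_⟩
  · rw [hg.K_eq]
    exact (hg.filtered n (i + 1) (by omega) (ModuleCat.of Aᵐᵒᵖ (trace (tailSum g (i + 1))
      (⊤ : Submodule Aᵐᵒᵖ (Submodule.span Aᵐᵒᵖ ({g i} : Set Aᵐᵒᵖ)))))
      (inferInstanceAs (Module.Finite Aᵐᵒᵖ (trace (tailSum g (i + 1))
        (⊤ : Submodule Aᵐᵒᵖ (Submodule.span Aᵐᵒᵖ ({g i} : Set Aᵐᵒᵖ)))))) (hproj i)
      ((trace_top_eq_top_iff _ _).2 (trace_self (hg.isIdempotentElem_tailSum _) _))).hasFiltration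
  · rw [hg.K_eq]
    exact hproj i

end StronglyQH

namespace StronglyQH

open CategoryTheory CategoryTheory.Limits

/-! ### Rejectivity from universal arrows -/

section Adjoints

variable {C : Type u} [Category.{v} C]

lemma isRightRejective_of_exists (D : ObjectProperty C)
    (h : ∀ X : C, ∃ (Y : C) (_ : D Y) (u : Y ⟶ X), Mono u ∧
      ∀ Z, D Z → ∀ f : Z ⟶ X, ∃ g : Z ⟶ Y, g ≫ u = f) : IsRightRejective D := by
  choose Y hY u hu lift hlift using h
  let G : C → D.FullSubcategory := fun X ↦ ⟨Y X, hY X⟩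
  let e : ∀ (Z : D.FullSubcategory) (X : C), (D.ι.obj Z ⟶ X) ≃ (Z ⟶ G X) := fun Z X ↦
    { toFun := fun f ↦ ObjectProperty.homMk (lift X Z.obj Z.property f)
      invFun := fun g ↦ g.hom ≫ u X
      left_inv := fun f ↦ hlift X Z.obj Z.property f
      right_inv := fun g ↦ by
        ext
        have := hu X
        rw [← cancel_mono (u X)]
        exact hlift X Z.obj Z.property _ }
  have he : ∀ X' X Y f g, e X' Y (D.ι.map f ≫ g) = f ≫ e X Y g := fun Z' Z X f g ↦ by
    apply (e Z' X).symm.injective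
    rw [Equiv.symm_apply_apply]
    change f.hom ≫ g = (f.hom ≫ lift X Z.obj Z.property g) ≫ u X
    rw [Category.assoc, hlift]
  refine ⟨_, Adjunction.adjunctionOfEquivRight e he, fun X ↦ ?_⟩
  have : (Adjunction.adjunctionOfEquivRight e he).counit.app X = 𝟙 _ ≫ u X := rfl
  rw [this, Category.id_comp]
  exact hu X

lemma isLeftRejective_of_exists (D : ObjectProperty C)
    (h : ∀ X : C, ∃ (Y : C) (_ : D Y) (u : X ⟶ Y), Epi u ∧
      ∀ Z, D Z → ∀ f : X ⟶ Z, ∃ g : Y ⟶ Z, u ≫ g = f) : IsLeftRejective D := by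
  choose Y hY u hu desc hdesc using h
  let G : C → D.FullSubcategory := fun X ↦ ⟨Y X, hY X⟩
  let e : ∀ (X : C) (Z : D.FullSubcategory), (G X ⟶ Z) ≃ (X ⟶ D.ι.obj Z) := fun X Z ↦
    { toFun := fun g ↦ u X ≫ g.hom
      invFun := fun f ↦ ObjectProperty.homMk (desc X Z.obj Z.property f)
      left_inv := fun g ↦ by
        ext
        have := hu X
        rw [← cancel_epi (u X)]
        exact hdesc X Z.obj Z.property _
      right_inv := fun f ↦ hdesc X Z.obj Z.property f }
  have he : ∀ X Y Y' g h, e X Y' (h ≫ g) = e X Y h ≫ D.ι.map g := fun X Z Z' g h ↦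
    (Category.assoc (u X) h.hom g.hom).symm
  refine ⟨_, Adjunction.adjunctionOfEquivLeft e he, fun X ↦ ?_⟩
  have : (Adjunction.adjunctionOfEquivLeft e he).unit.app X = u X ≫ 𝟙 _ := rfl
  rw [this, Category.comp_id]
  exact hu X

end Adjoints

/-! ### Right rejectivity of `add eA` -/

section ProjCat

variable {A : Type u} [Ring A]

/-- The object of `proj A` given by a finitely generated projective module. -/
def ProjCat.of (M : Type u) [AddCommGroup M] [Module Aᵐᵒᵖ M] [Module.Finite Aᵐᵒᵖ M]
    [Module.Projective Aᵐᵒᵖ M] : ProjCat A :=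
  ⟨ModuleCat.of Aᵐᵒᵖ M, inferInstanceAs (Module.Finite Aᵐᵒᵖ M),
    inferInstanceAs (Module.Projective Aᵐᵒᵖ M)⟩

instance (X : ProjCat A) : Module.Finite Aᵐᵒᵖ X.obj := X.property.1

instance (X : ProjCat A) : Module.Projective Aᵐᵒᵖ X.obj := X.property.2

/-- The morphism of `proj A` given by a linear map. -/
def ProjCat.ofLin {X Y : ProjCat A} (f : X.obj →ₗ[Aᵐᵒᵖ] Y.obj) : X ⟶ Y :=
  ObjectProperty.homMk (ModuleCat.ofHom f)

/-- The linear map underlying a morphism of `proj A`. -/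
def ProjCat.lin {X Y : ProjCat A} (f : X ⟶ Y) : X.obj →ₗ[Aᵐᵒᵖ] Y.obj := f.hom.hom

open ProjCat

lemma ProjCat.lin_injective {X Y : ProjCat A} {f g : X ⟶ Y} (h : lin f = lin g) : f = g := by
  ext x
  exact LinearMap.congr_fun h x

/-- `eA` as a left ideal of the opposite ring. -/
def opIdemEquiv (e : A) : Submodule.span Aᵐᵒᵖ ({MulOpposite.op e} : Set Aᵐᵒᵖ) ≃ₗ[Aᵐᵒᵖ]
    Submodule.span Aᵐᵒᵖ ({e} : Set A) :=
  let f : Aᵐᵒᵖ ≃ₗ[Aᵐᵒᵖ] A :=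
    { MulOpposite.opAddEquiv.symm with map_smul' := fun _ _ ↦ rfl }
  (f.submoduleMap _).trans (LinearEquiv.ofEq _ _ (by
    rw [Submodule.map_span, Set.image_singleton]; rfl))

/-- The regular right module is isomorphic to the regular module of the opposite ring. -/
def regularEquiv (A : Type u) [Ring A] : Aᵐᵒᵖ ≃ₗ[Aᵐᵒᵖ] A :=
  { MulOpposite.opAddEquiv.symm with map_smul' := fun _ _ ↦ rfl }

instance : Module.Finite Aᵐᵒᵖ A := .equiv (regularEquiv A)

instance : Module.Projective Aᵐᵒᵖ A := .of_equiv (regularEquiv A)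

lemma isIdempotentElem_op {e : A} (he : IsIdempotentElem e) :
    IsIdempotentElem (MulOpposite.op e) := congr_arg MulOpposite.op he

lemma addIdem_iff {e : A} (he : IsIdempotentElem e) (X : ProjCat A) :
    addIdem e X ↔ trace (MulOpposite.op e) (⊤ : Submodule Aᵐᵒᵖ X.obj) = ⊤ := by
  have he' := isIdempotentElem_op he
  constructor
  · rintro ⟨n, i, p, hip⟩
    refine trace_eq_top_of_surjective _ p (fun x ↦ ⟨i x, LinearMap.congr_fun hip x⟩) ?_
    exact trace_pi_eq_top _ _ fun _ ↦ trace_eq_top_of_surjective _ (opIdemEquiv e).toLinearMap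
      (opIdemEquiv e).surjective (trace_span_singleton he')
  · intro h
    obtain ⟨n, i, p, hip⟩ := exists_retract_of_trace_eq_top he' h
    let E := LinearEquiv.piCongrRight fun _ : Fin n ↦ opIdemEquiv e
    refine ⟨n, E.toLinearMap ∘ₗ i, p ∘ₗ E.symm.toLinearMap, ?_⟩
    ext x
    simpa using LinearMap.congr_fun hip x

variable [IsArtinianRing Aᵐᵒᵖ]

/-- The coreflection of `X` is its trace submodule. A map from an object of `add eA`, which equals
its own trace, lands there. -/
lemma isRightRejective_addIdem {e : A} (he : IsIdempotentElem e)
    (hP : Module.Projective Aᵐᵒᵖ (trace (MulOpposite.op e) (⊤ : Submodule Aᵐᵒᵖ Aᵐᵒᵖ))) :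
    IsRightRejective (addIdem e) := by
  have he' := isIdempotentElem_op he
  refine isRightRejective_of_exists _ fun X ↦ ?_
  have := projective_trace (M := X.obj) hP
  refine ⟨ProjCat.of (trace (MulOpposite.op e) (⊤ : Submodule Aᵐᵒᵖ X.obj)), ?_,
    ofLin (Submodule.subtype _), ⟨fun g h hgh ↦ ?_⟩, fun Z hZ f ↦ ?_⟩
  · rw [addIdem_iff he]
    exact (trace_top_eq_top_iff _ _).2 (trace_self he' _)
  · apply lin_injective
    ext1 z
    exact Subtype.ext (LinearMap.congr_fun (congr_arg lin hgh) z)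
  · rw [addIdem_iff he] at hZ
    refine ⟨ofLin ((lin f).codRestrict _ fun z ↦ apply_mem_trace _ (lin f) (Submodule.eq_top_iff'.1 hZ z)), ?_⟩
    apply lin_injective
    rfl

/-- The trace of `Y` is a quotient of a power of `eA`, through which a map from the projective `X`
lifts. -/
lemma factorsThrough_addIdem_iff {e : A} (he : IsIdempotentElem e) {X Y : ProjCat A} (f : X ⟶ Y) :
    FactorsThrough (addIdem e) f ↔ ∀ x, lin f x ∈ trace (MulOpposite.op e) ⊤ := by
  have he' := isIdempotentElem_op he
  constructor
  · rintro ⟨Z, hZ, a, b, rfl⟩ x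
    rw [addIdem_iff he] at hZ
    exact apply_mem_trace _ (lin b) (Submodule.eq_top_iff'.1 hZ _)
  · intro h
    obtain ⟨n, q, hq⟩ := exists_surjective_of_trace_eq_top he'
      ((trace_top_eq_top_iff _ _).2 (trace_self he' (⊤ : Submodule Aᵐᵒᵖ Y.obj)))
    obtain ⟨s, hs⟩ := Module.projective_lifting_property q ((lin f).codRestrict _ h) hq
    have := projective_span_singleton he'
    refine ⟨ProjCat.of (Fin n → Submodule.span Aᵐᵒᵖ ({MulOpposite.op e} : Set Aᵐᵒᵖ)), ?_,
      ofLin s, ofLin (Submodule.subtype _ ∘ₗ q), ?_⟩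
    · rw [addIdem_iff he]
      exact trace_pi_eq_top _ _ fun _ ↦ trace_span_singleton he'
    · apply lin_injective
      ext1 x
      exact congr_arg Subtype.val (LinearMap.congr_fun hs x)

end ProjCat

/-! ### Von Neumann regularity for semisimple quotients -/

section Semisimple

variable {B : Type u} [Ring B]

lemma isSemisimpleModule_of_jacobson_smul_eq_zero [IsArtinianRing B] (M : Type v) [AddCommGroup M]
    [Module B M] (h : ∀ a ∈ Ring.jacobson B, ∀ x : M, a • x = 0) : IsSemisimpleModule B M := by
  have h' : Module.IsTorsionBySet B M (Ring.jacobson B) := fun x a ↦ h a a.2 x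
  let _ := h'.module
  exact (h'.semilinearMap.isSemisimpleModule_iff_of_bijective Function.bijective_id).2 inferInstance

lemma exists_comp_comp_eq_self {M : Type v} [AddCommGroup M] [Module B M] {N : Type w}
    [AddCommGroup N] [Module B N] [IsSemisimpleModule B M] [IsSemisimpleModule B N]
    (f : M →ₗ[B] N) : ∃ g : N →ₗ[B] M, ∀ x, f (g (f x)) = f x := by
  obtain ⟨s, hs⟩ := IsSemisimpleModule.lifting_property f.rangeRestrict f.surjective_rangeRestrict
    LinearMap.id
  obtain ⟨g, hg⟩ := IsSemisimpleModule.extension_property (LinearMap.range f).subtype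
    (Submodule.subtype_injective _) s
  refine ⟨g, fun x ↦ ?_⟩
  have h1 : g (f x) = s (f.rangeRestrict x) := LinearMap.congr_fun hg (f.rangeRestrict x)
  rw [h1]
  exact congr_arg Subtype.val (LinearMap.congr_fun hs (f.rangeRestrict x))

/-- The submodule `J M + B e M`. -/
def radTrace (e : B) (M : Type v) [AddCommGroup M] [Module B M] : Submodule B M :=
  Ring.jacobson B • ⊤ ⊔ trace e ⊤

lemma radTrace_le_comap (e : B) {M : Type v} [AddCommGroup M] [Module B M] {N : Type w}
    [AddCommGroup N] [Module B N] (f : M →ₗ[B] N) : radTrace e M ≤ (radTrace e N).comap f := by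
  rw [← Submodule.map_le_iff_le_comap, radTrace, Submodule.map_sup, Submodule.map_smul'']
  exact sup_le_sup (smul_mono_right _ le_top) (map_trace_le e f)

instance [IsArtinianRing B] (e : B) (M : Type v) [AddCommGroup M] [Module B M] :
    IsSemisimpleModule B (M ⧸ radTrace e M) :=
  isSemisimpleModule_of_jacobson_smul_eq_zero _ fun a ha x ↦ by
    obtain ⟨x, rfl⟩ := Submodule.Quotient.mk_surjective _ x
    rw [← Submodule.Quotient.mk_smul, Submodule.Quotient.mk_eq_zero]
    exact Submodule.mem_sup_left (Submodule.smul_mem_smul ha trivial)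

end Semisimple

/-! ### Cosemisimplicity of consecutive subcategories -/

section Cosemisimple

variable {A : Type u} [Ring A] [IsArtinianRing Aᵐᵒᵖ]

-- Modulo `J M + B e' M` a morphism `f` has a quasi-inverse `g` with `f g f = f`. If `f` is radical,
-- then `1 - g f` is invertible and `f (1 - g f) = 0`, so `f` vanishes there. The hypothesis `hJ`
-- then removes the part in `J Y`.
open ProjCat in
lemma isCosemisimpleIn_addIdem {e e' : A} (he : IsIdempotentElem e) (he' : IsIdempotentElem e')
    (hJ : ∀ a ∈ Ring.jacobson Aᵐᵒᵖ, MulOpposite.op e * a * MulOpposite.op e ∈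
      trace (MulOpposite.op e') (⊤ : Submodule Aᵐᵒᵖ Aᵐᵒᵖ)) :
    IsCosemisimpleIn (addIdem e') (addIdem e) := by
  intro X Y hX hY f hf
  rw [addIdem_iff he] at hX hY
  rw [factorsThrough_addIdem_iff he']
  set ε := MulOpposite.op e
  set ε' := MulOpposite.op e'
  let f' : (X.obj ⧸ radTrace ε' X.obj) →ₗ[Aᵐᵒᵖ] (Y.obj ⧸ radTrace ε' Y.obj) :=
    Submodule.mapQ _ _ (lin f) (radTrace_le_comap ε' (lin f))
  obtain ⟨g', hg'⟩ := exists_comp_comp_eq_self f'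
  obtain ⟨g, hg⟩ := Module.projective_lifting_property (radTrace ε' X.obj).mkQ
    (g' ∘ₗ (radTrace ε' Y.obj).mkQ) (Submodule.mkQ_surjective _)
  have hgy : ∀ y, (Submodule.Quotient.mk (g y) : X.obj ⧸ radTrace ε' X.obj) =
      g' (Submodule.Quotient.mk y) := fun y ↦ LinearMap.congr_fun hg y
  obtain ⟨h, -, hh⟩ := hf (ofLin g)
  rw [factorsThrough_addIdem_iff he'] at hh
  have hf' : ∀ x, lin f x ∈ radTrace ε' Y.obj := fun x ↦ by
    have h1 : lin h x - g (lin f (lin h x)) - x ∈ radTrace ε' X.obj := Submodule.mem_sup_right (hh x)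
    rw [← Submodule.Quotient.mk_eq_zero, Submodule.Quotient.mk_sub, Submodule.Quotient.mk_sub, hgy]
      at h1
    have h2 := congr_arg f' h1
    rw [map_zero, map_sub, map_sub] at h2
    have h3 := hg' (Submodule.Quotient.mk (lin h x))
    have h4 : f' (g' (Submodule.Quotient.mk (lin f (lin h x)))) =
      f' (Submodule.Quotient.mk (lin h x)) := h3
    rw [h4, sub_self, zero_sub, neg_eq_zero] at h2
    exact (Submodule.Quotient.mk_eq_zero _).1 h2
  -- Since `Y` is generated by `ε Y`, `ε J Y` is generated additively by elements of `ε J ε Y`,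
  -- which `hJ` puts in the trace of `ε'`.
  have key : ∀ y ∈ radTrace ε' Y.obj, ε • y ∈ trace ε' (⊤ : Submodule Aᵐᵒᵖ Y.obj) := by
    have h1 : ∀ a ∈ Ring.jacobson Aᵐᵒᵖ, ∀ y : Y.obj, ε • a • y ∈
        trace ε' (⊤ : Submodule Aᵐᵒᵖ Y.obj) := by
      intro a ha y
      have hy : y ∈ trace ε (⊤ : Submodule Aᵐᵒᵖ Y.obj) := Submodule.eq_top_iff'.1 hY y
      rw [trace] at hy
      induction hy using Submodule.span_induction generalizing a with
      | mem y hy =>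
        obtain ⟨z, -, rfl⟩ := hy
        have := apply_mem_trace _ (LinearMap.toSpanSingleton Aᵐᵒᵖ Y.obj z) (hJ a ha)
        rwa [LinearMap.toSpanSingleton_apply, mul_smul, mul_smul] at this
      | zero => simp
      | add x y _ _ hx hy =>
        rw [smul_add, smul_add]; exact add_mem (hx a ha) (hy a ha)
      | smul b y _ hy =>
        rw [smul_smul a]; exact hy _ (Ideal.mul_mem_right _ _ ha)
    intro y hy
    obtain ⟨y₁, hy₁, y₂, hy₂, rfl⟩ := Submodule.mem_sup.1 hy
    rw [smul_add]
    refine add_mem ?_ (Submodule.smul_mem _ _ hy₂)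
    refine Submodule.smul_induction_on hy₁ (fun a ha y _ ↦ h1 a ha y) fun x y hx hy ↦ ?_
    rw [smul_add]; exact add_mem hx hy
  intro x
  have hle : trace ε (⊤ : Submodule Aᵐᵒᵖ X.obj) ≤ (trace ε' ⊤).comap (lin f) :=
    trace_le_iff.2 fun x _ ↦ by
      rw [Submodule.mem_comap, map_smul]; exact key _ (hf' x)
  exact hle (Submodule.eq_top_iff'.1 hX x)

end Cosemisimple
end StronglyQH

namespace StronglyQH

open CategoryTheory CategoryTheory.Limits MulOpposite

/-! ### Left rejectivity of `add eA` -/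

section LeftRejective

/-- Coordinates for the projective left module `AeA` as a retract of `(Ae)ⁿ`: the `c k` are the
images of the standard generators and the rows of `m` are the coordinates of the `c k`. -/
lemma exists_dual_basis {A : Type u} [Ring A] [IsArtinianRing A] {e : A} (he : IsIdempotentElem e)
    (hP : Module.Projective A (trace e (⊤ : Submodule A A))) :
    ∃ (n : ℕ) (c : Fin n → A) (m : Fin n → Fin n → A), (∀ k l, m k l * e = m k l) ∧
      (∀ k l, e * m k l = m k l) ∧ (∀ k, e * c k = c k) ∧ (∀ k, ∑ l, m k l * c l = c k) ∧
      (∀ h : Fin n → A, (∀ k, h k * e = h k) → ∑ k, h k * c k = 0 → ∀ l, ∑ k, h k * m k l = 0) ∧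
      ∀ b, ∃ w : Fin n → A, e * b = ∑ k, w k * c k := by
  classical
  obtain ⟨n, i, p, hip⟩ := exists_retract_of_trace_eq_top he
    ((trace_top_eq_top_iff e (trace e (⊤ : Submodule A A))).2 (trace_self he _))
  have hip' : ∀ x, p (i x) = x := fun x ↦ LinearMap.congr_fun hip x
  let s : Fin n → Fin n → Submodule.span A ({e} : Set A) := fun k ↦ Pi.single k (genIdem e)
  have hs : ∀ x : Fin n → Submodule.span A ({e} : Set A), x = ∑ k, (x k : A) • s k := fun x ↦ by
    conv_lhs => rw [← Finset.univ_sum_single x]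
    refine Finset.sum_congr rfl fun k _ ↦ ?_
    rw [← Pi.single_smul, ← eq_smul_genIdem he]
  have hp : ∀ x, (p x : A) = ∑ k, (x k : A) * p (s k) := fun x ↦ by
    conv_lhs => rw [hs x, map_sum]
    simp
  have hmem : ∀ x : Submodule.span A ({e} : Set A), (x : A) * e = x := fun x ↦
    (mem_span_singleton_iff_mul he).1 x.2
  refine ⟨n, fun k ↦ p (s k), fun k l ↦ i (p (s k)) l, fun k l ↦ hmem _, fun k l ↦ ?_, fun k ↦ ?_,
    fun k ↦ ?_, fun h hh h0 l ↦ ?_, fun b ↦ ?_⟩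
  · rw [← smul_eq_mul, ← Submodule.coe_smul, ← Pi.smul_apply, ← map_smul, ← map_smul,
      ← Pi.single_smul, smul_genIdem_self he]
  · rw [← smul_eq_mul, ← Submodule.coe_smul, ← map_smul, ← Pi.single_smul, smul_genIdem_self he]
  · rw [← hp, hip']
  · let h' : Fin n → Submodule.span A ({e} : Set A) :=
      fun k ↦ ⟨h k, (mem_span_singleton_iff_mul he).2 (hh k)⟩
    have h1 : p h' = 0 := Subtype.ext ((hp h').trans h0)
    have h2 : i (p h') l = 0 := by rw [h1, map_zero]; rfl
    rw [hs h', map_sum, map_sum] at h2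
    simpa [h'] using congr_arg Subtype.val h2
  · refine ⟨fun k ↦ i ⟨e * b, smul_mem_trace e trivial⟩ k, ?_⟩
    rw [← hp, hip']

variable {A : Type u} [Ring A]

/-- Left multiplication of columns by a matrix, as a map of right modules. -/
def leftMulMatrix {n : ℕ} (m : Fin n → Fin n → A) : (Fin n → A) →ₗ[Aᵐᵒᵖ] (Fin n → A) where
  toFun b k := ∑ l, m k l * b l
  map_add' b b' := by ext; simp [mul_add, Finset.sum_add_distrib]
  map_smul' r b := by ext; simp [Finset.sum_mul, mul_assoc]

/-- The map of right modules `(Fin n → A) → M`, `b ↦ ∑ y w_k b_k`. -/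
def columnMap {M : Type v} [AddCommGroup M] [Module Aᵐᵒᵖ M] {n : ℕ} (w : Fin n → A) (y : M) :
    (Fin n → A) →ₗ[Aᵐᵒᵖ] M where
  toFun b := op (∑ k, w k * b k) • y
  map_add' b b' := by simp [mul_add, Finset.sum_add_distrib, add_smul]
  map_smul' r b := by
    have h : ∑ k, w k * (r • b) k = (∑ k, w k * b k) * unop r := by
      rw [Finset.sum_mul]
      exact Finset.sum_congr rfl fun k _ ↦ (mul_assoc _ _ _).symm
    rw [h, op_mul, op_unop, mul_smul, RingHom.id_apply]

/-- `Y = m Aⁿ` is the dual `Hom(AeA, A)`, and the column `y = c` corresponds to the inclusion of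
`AeA` into `A`. So `1 ↦ y` is the reflection of the regular module. -/
lemma exists_regular_reflection [IsArtinianRing A] [IsArtinianRing Aᵐᵒᵖ] {e : A}
    (he : IsIdempotentElem e)
    (hP : Module.Projective A (trace e (⊤ : Submodule A A))) :
    ∃ (Y : ProjCat A) (y : Y.obj), trace (op e) (⊤ : Submodule Aᵐᵒᵖ Y.obj) = ⊤ ∧
      (∀ (Z : ProjCat A), trace (op e) (⊤ : Submodule Aᵐᵒᵖ Z.obj) = ⊤ → ∀ z : Z.obj,
        ∃ h : Y.obj →ₗ[Aᵐᵒᵖ] Z.obj, h y = z) ∧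
      ∀ h : Y.obj →ₗ[Aᵐᵒᵖ] A, h y = 0 → h = 0 := by
  classical
  obtain ⟨n, c, m, hme, hem, hec, hmc, hker, hex⟩ := exists_dual_basis he hP
  let Φ := leftMulMatrix m
  have hΦ : ∀ b k, Φ b k = ∑ l, m k l * b l := fun _ _ ↦ rfl
  -- The row `m_k - e δ_k` is a relation among the `c l`, since `m c = c = e c`; applying `hker` to
  -- it gives `m m = e m`.
  have hmm : ∀ k i, ∑ l, m k l * m l i = e * m k i := fun k i ↦ by
    have h1 := hker (fun l ↦ m k l - if l = k then e else 0) (fun l ↦ by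
      split_ifs
      · rw [sub_mul, hme, he.eq]
      · rw [sub_zero, hme]) (by
      simp [sub_mul, Finset.sum_sub_distrib, hmc, hec]) i
    simpa [sub_mul, Finset.sum_sub_distrib, sub_eq_zero] using h1
  have hΦΦ : ∀ b, Φ (Φ b) = Φ b := fun b ↦ by
    ext k
    simp_rw [hΦ, Finset.mul_sum, ← mul_assoc]
    rw [Finset.sum_comm]
    simp_rw [← Finset.sum_mul, hmm, hem]
  let Ψ := Φ.rangeRestrict
  have hΨ : Function.Surjective Ψ := Φ.surjective_rangeRestrict
  have hΨs : Ψ ∘ₗ (LinearMap.range Φ).subtype = LinearMap.id := by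
    ext1 ⟨_, b, rfl⟩
    exact Subtype.ext (hΦΦ b)
  have : Module.Projective Aᵐᵒᵖ (LinearMap.range Φ) := .of_split _ Ψ hΨs
  have hb : ∀ b : Fin n → A, b = ∑ l, op (b l) • (Pi.single l 1 : Fin n → A) := fun b ↦ by
    conv_lhs => rw [← Finset.univ_sum_single b]
    refine Finset.sum_congr rfl fun k _ ↦ ?_
    rw [← Pi.single_smul, op_smul_eq_mul, one_mul]
  refine ⟨ProjCat.of (LinearMap.range Φ), (⟨c, c, funext hmc⟩ : LinearMap.range Φ), ?_,
    fun Z hZ z ↦ ?_, fun h hh ↦ ?_⟩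
  · refine eq_top_iff.2 fun x _ ↦ ?_
    obtain ⟨b, rfl⟩ := hΨ x
    have h1 : Ψ b = ∑ l, op (b l) • op e • Ψ (Pi.single l 1) := by
      have h2 : Φ b = Φ (∑ l, op (b l) • op e • (Pi.single l 1 : Fin n → A)) := by
        ext k
        rw [hΦ, hΦ]
        refine Finset.sum_congr rfl fun l _ ↦ ?_
        conv_lhs => rw [← hme]
        simp [Finset.sum_apply, Pi.single_apply, mul_assoc]
      simp_rw [← map_smul, ← map_sum]
      exact Subtype.ext h2
    rw [h1]
    exact Submodule.sum_mem _ fun l _ ↦ Submodule.smul_mem _ _ (smul_mem_trace _ trivial)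
  -- The factor `b` is carried along so that span induction passes through scalar multiples. On a
  -- generator `z' e`, the element `e b` is a combination of the `c k`, and its coefficients define
  -- the map.
  · have h1 : ∀ b : Aᵐᵒᵖ, ∃ h : LinearMap.range Φ →ₗ[Aᵐᵒᵖ] Z.obj, h ⟨c, c, funext hmc⟩ = b • z := by
      have hz : z ∈ trace (op e) (⊤ : Submodule Aᵐᵒᵖ Z.obj) := Submodule.eq_top_iff'.1 hZ z
      rw [trace] at hz
      induction hz using Submodule.span_induction with
      | mem z hz =>
        obtain ⟨z', -, rfl⟩ := hz
        intro b
        obtain ⟨w, hw⟩ := hex (unop b)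
        refine ⟨columnMap w z' ∘ₗ Submodule.subtype _, ?_⟩
        change op (∑ k, w k * c k) • z' = b • op e • z'
        rw [← hw, op_mul, op_unop, mul_smul]
      | zero => exact fun b ↦ ⟨0, by simp⟩
      | add x y _ _ hx hy =>
        intro b
        obtain ⟨h, hh⟩ := hx b
        obtain ⟨h', hh'⟩ := hy b
        exact ⟨h + h', by rw [LinearMap.add_apply, hh, hh', smul_add]⟩
      | smul r x _ hx =>
        intro b
        simpa only [mul_smul] using hx (b * r)
    obtain ⟨h, hh⟩ := h1 1
    exact ⟨h, hh.trans (one_smul _ _)⟩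
  · let H : (Fin n → A) →ₗ[Aᵐᵒᵖ] A := h ∘ₗ Ψ
    have hH : ∀ b, H b = ∑ k, H (Pi.single k 1) * b k := fun b ↦ by
      conv_lhs => rw [hb b, map_sum]
      simp only [map_smul, op_smul_eq_mul]
    have hHΦ : ∀ b, H (Φ b) = H b := fun b ↦ congr_arg h (Subtype.ext (hΦΦ b))
    have hHm : ∀ l, H (Pi.single l 1) = ∑ k, H (Pi.single k 1) * m k l := fun l ↦ by
      rw [← hHΦ, hH]
      simp [hΦ, Pi.single_apply]
    have h0 : ∀ l, H (Pi.single l 1) = 0 := fun l ↦ by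
      rw [hHm]
      refine hker (fun k ↦ H (Pi.single k 1)) (fun k ↦ ?_) ?_ l
      · rw [hHm, Finset.sum_mul]
        simp_rw [mul_assoc, hme]
      · rw [← hH]
        exact (congr_arg h (Subtype.ext (funext hmc))).trans hh
    refine LinearMap.ext fun x ↦ ?_
    obtain ⟨b, rfl⟩ := hΨ x
    change H b = 0
    rw [hH]
    simp [h0]

-- `Aʳ` is reflected to `Yʳ`. An object `X` is a retract of some `Aʳ`, and the corresponding
-- idempotent induces an idempotent `φ` of `Yʳ`, whose range is the reflection of `X`.
open ProjCat in
lemma isLeftRejective_addIdem [IsArtinianRing A] [IsArtinianRing Aᵐᵒᵖ] {e : A}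
    (he : IsIdempotentElem e) (hP : Module.Projective A (trace e (⊤ : Submodule A A))) :
    IsLeftRejective (addIdem e) := by
  classical
  obtain ⟨Y, y, hY, hlift, huniq⟩ := exists_regular_reflection he hP
  have huniq' : ∀ (Z : ProjCat A) (h h' : Y.obj →ₗ[Aᵐᵒᵖ] Z.obj), h y = h' y → h = h' := by
    intro Z h h' hh
    obtain ⟨t, q, hq⟩ := Module.Finite.exists_fin' Aᵐᵒᵖ Z.obj
    obtain ⟨s, hs⟩ := Module.projective_lifting_property q LinearMap.id hq
    refine LinearMap.ext fun x ↦ (LinearMap.congr_fun hs (h x)).symm.trans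
      (.trans (congr_arg q ?_) (LinearMap.congr_fun hs (h' x)))
    funext l
    have h0 := huniq ((regularEquiv A).toLinearMap ∘ₗ LinearMap.proj l ∘ₗ s ∘ₗ (h - h'))
      (by simp [hh])
    have h1 := (regularEquiv A).map_eq_zero_iff.1 (LinearMap.congr_fun h0 x)
    exact sub_eq_zero.1 ((congr_fun (map_sub s (h x) (h' x)) l).symm.trans h1)
  refine isLeftRejective_of_exists _ fun X ↦ ?_
  obtain ⟨r, q, hq⟩ := Module.Finite.exists_fin' Aᵐᵒᵖ X.obj
  obtain ⟨s, hs⟩ := Module.projective_lifting_property q LinearMap.id hq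
  have hqs : ∀ x, q (s x) = x := LinearMap.congr_fun hs
  let U : (Fin r → Aᵐᵒᵖ) →ₗ[Aᵐᵒᵖ] (Fin r → Y.obj) :=
    LinearMap.pi fun j ↦ LinearMap.toSpanSingleton Aᵐᵒᵖ Y.obj y ∘ₗ LinearMap.proj j
  have hU : ∀ j, U (Pi.single j 1) = Pi.single j y := fun j ↦ by
    ext l
    rcases eq_or_ne l j with rfl | hlj <;> simp [U, *]
  have hlift' : ∀ Z : ProjCat A, addIdem e Z → ∀ f : (Fin r → Aᵐᵒᵖ) →ₗ[Aᵐᵒᵖ] Z.obj,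
      ∃ h : (Fin r → Y.obj) →ₗ[Aᵐᵒᵖ] Z.obj, h ∘ₗ U = f := by
    intro Z hZ f
    choose h hh using fun j ↦ hlift Z ((addIdem_iff he Z).1 hZ) (f (Pi.single j 1))
    refine ⟨LinearMap.lsum Aᵐᵒᵖ (fun _ ↦ Y.obj) ℕ h, ?_⟩
    ext j
    simp only [LinearMap.comp_apply, LinearMap.single_apply, hU]
    simpa using (LinearMap.lsum_piSingle Aᵐᵒᵖ _ ℕ h j y).trans (hh j)
  have hext : ∀ (Z : ProjCat A) (h h' : (Fin r → Y.obj) →ₗ[Aᵐᵒᵖ] Z.obj),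
      (∀ x, h (U x) = h' (U x)) → h = h' := by
    intro Z h h' hh
    refine LinearMap.pi_ext' fun j ↦ huniq' Z _ _ ?_
    simpa [hU] using hh (Pi.single j 1)
  let V : ProjCat A := ProjCat.of (Fin r → Y.obj)
  have hV : trace (op e) (⊤ : Submodule Aᵐᵒᵖ (Fin r → Y.obj)) = ⊤ := trace_pi_eq_top _ _ fun _ ↦ hY
  obtain ⟨φ, hφ⟩ := hlift' V ((addIdem_iff he V).2 hV) (U ∘ₗ s ∘ₗ q)
  have hφU : ∀ x, φ (U x) = U (s (q x)) := LinearMap.congr_fun hφ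
  have hφφ : φ ∘ₗ φ = φ := hext V _ _ fun x ↦ by
    change φ (φ (U x)) = φ (U x)
    rw [hφU, hφU, hqs]
  let Ψ := φ.rangeRestrict
  have hΨ : Function.Surjective Ψ := φ.surjective_rangeRestrict
  have hΨs : Ψ ∘ₗ (LinearMap.range φ).subtype = LinearMap.id := by
    ext1 ⟨_, b, rfl⟩
    exact Subtype.ext (LinearMap.congr_fun hφφ b)
  have : Module.Projective Aᵐᵒᵖ (LinearMap.range φ) := .of_split _ Ψ hΨs
  refine ⟨ProjCat.of (LinearMap.range φ), ?_, ofLin (Ψ ∘ₗ U ∘ₗ s), ⟨fun {Z} g g' hg ↦ ?_⟩,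
    fun Z hZ f ↦ ?_⟩
  · exact (addIdem_iff he _).2 (trace_eq_top_of_surjective _ Ψ hΨ hV)
  · have hg' : ∀ x, lin g (Ψ (U (s x))) = lin g' (Ψ (U (s x))) :=
      LinearMap.congr_fun (congr_arg lin hg)
    have hΨU : ∀ x, Ψ (U x) = Ψ (U (s (q x))) := fun x ↦ by
      refine Subtype.ext ?_
      change φ (U x) = φ (U (s (q x)))
      rw [hφU, hφU, hqs]
    have h1 : lin g ∘ₗ Ψ = lin g' ∘ₗ Ψ := hext Z _ _ fun x ↦ by
      change lin g (Ψ (U x)) = lin g' (Ψ (U x))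
      rw [hΨU, hg']
    apply lin_injective
    refine LinearMap.ext fun x ↦ ?_
    obtain ⟨b, rfl⟩ := hΨ x
    exact LinearMap.congr_fun h1 b
  · obtain ⟨h, hh⟩ := hlift' Z hZ (lin f ∘ₗ q)
    refine ⟨ofLin (h ∘ₗ (LinearMap.range φ).subtype), ?_⟩
    apply lin_injective
    refine LinearMap.ext fun x ↦ ?_
    change h (φ (U (s x))) = lin f x
    have h1 : h (U (s x)) = lin f (q (s x)) := LinearMap.congr_fun hh (s x)
    rw [hφU, hqs, h1, hqs]

end LeftRejective
end StronglyQH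

namespace StronglyQH

open CategoryTheory CategoryTheory.Limits MulOpposite

/-! ### Assembling the rejective chains -/

section Chains

/-- A sequence of idempotents `e 0, …, e n = 0` of `B`, with `e (i + 1) ∈ (e i) B (e i)`, whose
two-sided ideals strictly decrease from `B` to `0`, and such that `(e i) J (e i)` is contained in
the ideal of `e (i + 1)`, where `J` is the Jacobson radical. -/
structure IsIdempotentChain {B : Type u} [Ring B] {n : ℕ} (e : Fin (n + 1) → B) : Prop where
  idem : ∀ i, IsIdempotentElem (e i)
  zero : trace (e 0) (⊤ : Submodule B B) = ⊤
  last : e (Fin.last n) = 0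
  mul_succ : ∀ i : Fin n, e i.castSucc * e i.succ = e i.succ
  succ_mul : ∀ i : Fin n, e i.succ * e i.castSucc = e i.succ
  notMem : ∀ i : Fin n, e i.castSucc ∉ trace (e i.succ) (⊤ : Submodule B B)
  mul_mem : ∀ i : Fin n, ∀ a ∈ Ring.jacobson B,
    e i.castSucc * a * e i.castSucc ∈ trace (e i.succ) (⊤ : Submodule B B)

lemma IsRejectiveFamily.isIdempotentChain {B : Type u} [Ring B] [IsArtinianRing B] {n : ℕ}
    {g : Fin n → B} (hg : IsRejectiveFamily g) :
    IsIdempotentChain fun k : Fin (n + 1) ↦ tailSum g k := by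
  have hsucc : ∀ i : Fin n, tailSum g i = g i + tailSum g (i + 1) := fun i ↦ by
    rw [tailSum, tailSum, ← Finset.sum_insert (by simp)]
    refine Finset.sum_congr ?_ fun _ _ ↦ rfl
    ext j
    simp [Fin.ext_iff]
    omega
  have h1 : ∀ i : Fin n, tailSum g i * tailSum g (i + 1) = tailSum g (i + 1) := fun i ↦ by
    conv_lhs => rw [tailSum, tailSum, Finset.mul_sum]
    refine Finset.sum_congr rfl fun j hj ↦ hg.tailSum_mul ?_
    have := (Finset.mem_filter.1 hj).2
    omega
  have h2 : ∀ i : Fin n, tailSum g (i + 1) * tailSum g i = tailSum g (i + 1) := fun i ↦ by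
    conv_lhs => rw [tailSum, Finset.sum_mul]
    refine Finset.sum_congr rfl fun j hj ↦ hg.mul_tailSum ?_
    have := (Finset.mem_filter.1 hj).2
    omega
  refine ⟨fun i ↦ hg.isIdempotentElem_tailSum _, hg.trace_tailSum_zero, tailSum_of_le g le_rfl, h1,
    h2, fun i hi ↦ ?_, fun i a ha ↦ ?_⟩
  · obtain ⟨t, ht⟩ := hg.tailSum_smul_ne_zero (le_refl i.val)
    have h3 := apply_mem_trace _ (LinearMap.toSpanSingleton B _ t) hi
    have h4 : trace (tailSum g (i + 1))
        (⊤ : Submodule B (Submodule.span B ({g i} : Set B) ⧸ radIdem (g i))) ≤ ⊥ :=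
      trace_le_iff.2 fun x _ ↦ hg.tailSum_smul_eq_zero (Nat.lt_succ_self _) x
    exact ht (h4 h3)
  · change tailSum g i * a * tailSum g i ∈ trace (tailSum g (i + 1)) ⊤
    have h3 : tailSum g i * a * tailSum g i =
        tailSum g i * a * g i + (tailSum g i * a) • tailSum g (i + 1) • (1 : B) := by
      rw [smul_eq_mul, smul_eq_mul, mul_one, ← mul_add, ← hsucc]
    rw [h3]
    exact add_mem (hg.mul_mem_trace i a ha) (Submodule.smul_mem _ _ (smul_mem_trace _ trivial))

variable {A : Type u} [Ring A]

/-- The two-sided ideal generated by `e` is the same for `A` and for the opposite ring. -/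
lemma op_mem_trace_iff {e x : A} : op x ∈ trace (op e) (⊤ : Submodule Aᵐᵒᵖ Aᵐᵒᵖ) ↔
    x ∈ trace e (⊤ : Submodule A A) := by
  constructor
  · intro h
    suffices ∀ y ∈ trace (op e) (⊤ : Submodule Aᵐᵒᵖ Aᵐᵒᵖ),
        ∀ b, unop y * b ∈ trace e (⊤ : Submodule A A) by simpa using this _ h 1
    intro y hy
    rw [trace] at hy
    induction hy using Submodule.span_induction with
    | mem y hy =>
      obtain ⟨z, -, rfl⟩ := hy
      intro b
      change unop z * e * b ∈ _
      rw [mul_assoc]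
      exact Submodule.smul_mem _ _ (smul_mem_trace e (x := b) trivial)
    | zero => simp
    | add x y _ _ hx hy =>
      intro b
      rw [MulOpposite.unop_add, add_mul]
      exact add_mem (hx b) (hy b)
    | smul r y _ hy =>
      intro b
      rw [smul_eq_mul, unop_mul, mul_assoc]
      exact hy _
  · intro h
    suffices ∀ y ∈ trace e (⊤ : Submodule A A),
        ∀ b, op (b * y) ∈ trace (op e) (⊤ : Submodule Aᵐᵒᵖ Aᵐᵒᵖ) by simpa using this _ h 1
    intro y hy
    rw [trace] at hy
    induction hy using Submodule.span_induction with
    | mem y hy =>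
      obtain ⟨z, -, rfl⟩ := hy
      intro b
      change op (b * (e * z)) ∈ _
      rw [← mul_assoc, op_mul, op_mul]
      exact Submodule.smul_mem _ _ (smul_mem_trace (op e) (x := op b) trivial)
    | zero => simp
    | add x y _ _ hx hy =>
      intro b
      rw [mul_add, MulOpposite.op_add]
      exact add_mem (hx b) (hy b)
    | smul r y _ hy =>
      intro b
      rw [smul_eq_mul, ← mul_assoc]
      exact hy _

lemma IsIdempotentChain.opposite [IsArtinianRing A] [IsArtinianRing Aᵐᵒᵖ] {n : ℕ} {e : Fin (n + 1) → A}
    (h : IsIdempotentChain e) : IsIdempotentChain fun i ↦ op (e i) where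
  idem i := isIdempotentElem_op (h.idem i)
  zero := eq_top_iff.2 fun x _ ↦ by
    rw [← op_unop x, op_mem_trace_iff, h.zero]
    trivial
  last := by rw [h.last, MulOpposite.op_zero]
  mul_succ i := by rw [← op_mul, h.succ_mul]
  succ_mul i := by rw [← op_mul, h.mul_succ]
  notMem i hi := h.notMem i (op_mem_trace_iff.1 hi)
  mul_mem i a ha := by
    rw [← op_unop a, ← op_mul, ← op_mul, op_mem_trace_iff, ← mul_assoc]
    exact h.mul_mem i _ ((mem_jacobson_iff_of_opEquiv (RingEquiv.refl Aᵐᵒᵖ) a).2 ha)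

lemma addIdem_zero_iff (X : ProjCat A) : addIdem (0 : A) X ↔ IsZero X := by
  have h0 : trace (op (0 : A)) (⊤ : Submodule Aᵐᵒᵖ X.obj) = ⊥ :=
    le_bot_iff.1 (trace_le_iff.2 fun x _ ↦ by simp)
  rw [addIdem_iff .zero, h0, IsZero.iff_id_eq_zero]
  constructor
  · intro h
    apply ProjCat.lin_injective
    refine LinearMap.ext fun x ↦ ?_
    exact (Submodule.mem_bot _).1 (h ▸ Submodule.mem_top : x ∈ (⊥ : Submodule Aᵐᵒᵖ X.obj))
  · intro h
    refine eq_top_iff.2 fun x _ ↦ ?_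
    exact LinearMap.congr_fun (congr_arg ProjCat.lin h) x

/-- Strictness is witnessed by `eA`: if it lay in `add e'A`, its generator `e` would lie in the
ideal of `e'`. -/
lemma addIdem_lt {e e' : A} (he : IsIdempotentElem e) (he' : IsIdempotentElem e')
    (hmul : e' * e = e') (hne : op e ∉ trace (op e') (⊤ : Submodule Aᵐᵒᵖ Aᵐᵒᵖ)) :
    addIdem e' < addIdem e := by
  refine lt_of_le_not_ge (fun X hX ↦ ?_) fun hle ↦ ?_
  · rw [addIdem_iff he'] at hX
    exact (addIdem_iff he X).2 (eq_top_iff.2 (hX.ge.trans (trace_anti (by rw [← op_mul, hmul]) _)))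
  · have hop := isIdempotentElem_op he
    have := projective_span_singleton hop
    have h1 : trace (op e') (⊤ : Submodule Aᵐᵒᵖ (Submodule.span Aᵐᵒᵖ ({op e} : Set Aᵐᵒᵖ))) = ⊤ :=
      (addIdem_iff he' _).1 (hle (ProjCat.of (Submodule.span Aᵐᵒᵖ ({op e} : Set Aᵐᵒᵖ)))
        ((addIdem_iff he _).2 (trace_span_singleton hop)))
    exact hne (apply_mem_trace _ (Submodule.subtype _)
      (Submodule.eq_top_iff'.1 h1 (genIdem (op e))))

lemma IsIdempotentChain.idem_unop {n : ℕ} {e : Fin (n + 1) → A}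
    (h : IsIdempotentChain fun i ↦ op (e i)) (i) : IsIdempotentElem (e i) :=
  op_injective (h.idem i)

lemma IsIdempotentChain.addIdem_zero {n : ℕ} {e : Fin (n + 1) → A}
    (h : IsIdempotentChain fun i ↦ op (e i)) (X : ProjCat A) : addIdem (e 0) X := by
  rw [addIdem_iff (h.idem_unop 0), eq_top_iff]
  intro x _
  have h1 : (1 : Aᵐᵒᵖ) ∈ trace (op (e 0)) (⊤ : Submodule Aᵐᵒᵖ Aᵐᵒᵖ) := by rw [h.zero]; trivial
  simpa using apply_mem_trace _ (LinearMap.toSpanSingleton Aᵐᵒᵖ X.obj x) h1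

lemma IsIdempotentChain.addIdem_last {n : ℕ} {e : Fin (n + 1) → A}
    (h : IsIdempotentChain fun i ↦ op (e i)) (X : ProjCat A) :
    addIdem (e (Fin.last n)) X ↔ IsZero X := by
  rw [op_injective (h.last.trans MulOpposite.op_zero.symm), addIdem_zero_iff]

lemma IsIdempotentChain.strictAnti_addIdem {n : ℕ} {e : Fin (n + 1) → A}
    (h : IsIdempotentChain fun i ↦ op (e i)) : StrictAnti fun i ↦ addIdem (e i) :=
  Fin.strictAnti_iff_succ_lt.2 fun i ↦ addIdem_lt (h.idem_unop _) (h.idem_unop _)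
    (op_injective (h.mul_succ i)) (h.notMem i)

lemma IsIdempotentChain.isCosemisimpleIn [IsArtinianRing Aᵐᵒᵖ] {n : ℕ} {e : Fin (n + 1) → A}
    (h : IsIdempotentChain fun i ↦ op (e i)) (i : Fin n) :
    IsCosemisimpleIn (addIdem (e i.succ)) (addIdem (e i.castSucc)) :=
  isCosemisimpleIn_addIdem (h.idem_unop _) (h.idem_unop _) (h.mul_mem i)

lemma KernelsProjective.exists_isTotalRightRejectiveChain [IsArtinianRing Aᵐᵒᵖ]
    (hK : KernelsProjective Aᵐᵒᵖ) : ∃ (n : ℕ) (e : Fin (n + 1) → A), (∀ i, IsIdempotentElem (e i)) ∧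
      IsTotalRightRejectiveChain fun i ↦ addIdem (e i) := by
  obtain ⟨n, g, hg⟩ := hK.exists_isRejectiveFamily
  have h : IsIdempotentChain fun k : Fin (n + 1) ↦ op (unop (tailSum g k)) := hg.isIdempotentChain
  exact ⟨n, _, h.idem_unop, h.addIdem_zero, h.addIdem_last, h.strictAnti_addIdem,
    fun i ↦ isRightRejective_addIdem (h.idem_unop _) (hg.projective _), h.isCosemisimpleIn⟩

/-- The chain is built from left `A`-modules, as left rejectivity needs `AeA` projective on the
left. The remaining conditions concern two-sided ideals and the radical and transfer to `Aᵐᵒᵖ`. -/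
lemma KernelsProjective.exists_isTotalLeftRejectiveChain [IsArtinianRing A] [IsArtinianRing Aᵐᵒᵖ]
    (hK : KernelsProjective A) : ∃ (n : ℕ) (e : Fin (n + 1) → A), (∀ i, IsIdempotentElem (e i)) ∧
      IsTotalLeftRejectiveChain fun i ↦ addIdem (e i) := by
  obtain ⟨n, g, hg⟩ := hK.exists_isRejectiveFamily
  have h := hg.isIdempotentChain.opposite
  exact ⟨n, _, h.idem_unop, h.addIdem_zero, h.addIdem_last, h.strictAnti_addIdem,
    fun i ↦ isLeftRejective_addIdem (h.idem_unop _) (hg.projective _), h.isCosemisimpleIn⟩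

end Chains
end StronglyQH

theorem theorem1p3 {R : Type v} {A : Type u} [CommRing R] [IsArtinianRing R] [Ring A]
    [Algebra R A] [Module.Finite R A] (hA : StronglyQH.globalDimension A ≤ 2) :
    StronglyQH.IsRightStronglyQuasiHereditary A ∧
    StronglyQH.IsLeftStronglyQuasiHereditary A ∧
    (∃ (n : ℕ) (e : Fin (n + 1) → A), (∀ i, IsIdempotentElem (e i)) ∧
      StronglyQH.IsTotalRightRejectiveChain (fun i ↦ StronglyQH.addIdem (e i))) ∧
    (∃ (n : ℕ) (e : Fin (n + 1) → A), (∀ i, IsIdempotentElem (e i)) ∧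
      StronglyQH.IsTotalLeftRejectiveChain (fun i ↦ StronglyQH.addIdem (e i))) := by
  have : Module.Finite R Aᵐᵒᵖ := .equiv (MulOpposite.opLinearEquiv R)
  have : Module.Finite R Aᵐᵒᵖᵐᵒᵖ := .equiv (MulOpposite.opLinearEquiv R)
  have : IsArtinianRing A := .of_finite R A
  have : IsArtinianRing Aᵐᵒᵖ := .of_finite R Aᵐᵒᵖ
  have : IsArtinianRing Aᵐᵒᵖᵐᵒᵖ := .of_finite R Aᵐᵒᵖᵐᵒᵖ
  have hK := StronglyQH.kernelsProjective_of_globalDimension_le_two hA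
  have hK' : StronglyQH.KernelsProjective A := hK.of_opEquiv (RingEquiv.refl _)
  have hK'' : StronglyQH.KernelsProjective Aᵐᵒᵖᵐᵒᵖ := hK.of_opEquiv (RingEquiv.opOp _)
  exact ⟨hK.isRightStronglyQuasiHereditary, hK''.isRightStronglyQuasiHereditary,
    hK.exists_isTotalRightRejectiveChain, hK'.exists_isTotalLeftRejectiveChain⟩
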